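/- Let $G=(V,E)$ be a finite graph, let $R,Q\subseteq V$ with $Q\cup R=V$, and let $r_{uv}\in\{0,1,2\}$ be connectivity requirements for the pairs of distinct terminals $u,v\in R$; let $D_r=\{uv: u,v\in R,\ u\ne v,\ r_{uv}>0\}$. The graph $G$ is $(r,Q)$-connected if for every $uv\in D_r$ there are $r_{uv}$ $uv$-paths of which no two share an edge or a node of $Q\setminus\{u,v\}$, and it is minimally $(r,Q)$-connected if in addition no proper subgraph of $G$ containing $R$ is $(r,Q)$-connected. For a connected component $C$ of $G\setminus R$, the $R$-component $T_C$ is the subgraph of $G$ with node set $C\cup\Gamma_G(C)$, where $\Gamma_G(C)$ is the set of neighbors of $C$ outside $C$, whose edges are all edges of $G$ with at least one endnode in $C$. A DFS cycle of $T_C$ is a simple cycle obtained by traversing the tree $T_C$ in a DFS order (a closed walk that uses every edge of $T_C$ exactly once in each direction), choosing a different copy of a node $v\in C$ each time $v$ is visited; thus every $v\in C$ is replaced by $\deg_{T_C}(v)$ copies, which are nodes of $Q$ in the new graph, and every terminal of $T_C$ appears once. A graph $(V',E')$ with edge capacities $0\le x_e\le 1$ is fractionally $(r,Q')$-connected if for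 all $X\subseteq X^+\subseteq V'$ with $X^+\setminus X\subseteq Q'$ and all $uv\in D_r$ with $u\in X$, $v\in V'\setminus X^+$, the total capacity of the edges between $X$ and $V'\setminus X^+$ is at least $r_{uv}-|X^+\setminus X|$. Let $G$ be minimally $(r,Q)$-connected. Then every $R$-component of $G$ is a tree. Furthermore, for any set $\mathcal C$ of connected components of $G\setminus R$, each tree $T_C$ with $C\in\mathcal C$ has a DFS cycle, and replacing $T_C$, for each $C\in\mathcal C$, by any DFS cycle of it with capacity $1/2$ on its edges (all the other edges of $G$ keeping capacity $1$) results in a fractionally $(r,Q')$-connected graph, where $Q'$ is obtained from $Q$ by replacing every node of $\bigcup\mathcal C$ by its copies. -/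

import Mathlib

namespace SurvivableNetwork

variable {V : Type*}

/-! ### `(r,Q)`-connectivity -/

/-- `k` pairwise `(E ∪ Q \ {u,v})`-disjoint `uv`-paths exist in `G`: no two of them share an edge,
and no two of them share a node of `Q` other than `u, v`. -/
def HasDisjointPaths (G : SimpleGraph V) (Q : Set V) (u v : V) (k : ℕ) : Prop :=
  ∃ P : Fin k → G.Path u v, ∀ i j : Fin k, i ≠ j →
    (∀ e, e ∈ (P i : G.Walk u v).edges → e ∉ (P j : G.Walk u v).edges) ∧
    (∀ w, w ∈ Q → w ≠ u → w ≠ v →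
      w ∈ (P i : G.Walk u v).support → w ∉ (P j : G.Walk u v).support)

/-- The `Q`-connectivity `λ^Q_G(u,v)`: the maximum number of pairwise
`(E ∪ Q \ {u,v})`-disjoint `uv`-paths in `G`. -/
noncomputable def qConnectivity (G : SimpleGraph V) (Q : Set V) (u v : V) : ℕ∞ :=
  ⨆ (k : ℕ) (_ : HasDisjointPaths G Q u v k), (k : ℕ∞)

/-- The demand edges `D_r`: unordered pairs of distinct terminals with positive requirement. -/
def demandEdges (R : Set V) (r : Sym2 V → ℕ) : Set (Sym2 V) :=
  {e | ¬ e.IsDiag ∧ (∀ v ∈ e, v ∈ R) ∧ 0 < r e}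

/-- `G` is `(r,Q)`-connected, where `r` is a requirement function on the terminal set `R`. -/
def IsRQConnected (G : SimpleGraph V) (R : Set V) (r : Sym2 V → ℕ) (Q : Set V) : Prop :=
  ∀ u v : V, s(u, v) ∈ demandEdges R r → (r s(u, v) : ℕ∞) ≤ qConnectivity G Q u v

/-- `G` is minimally `(r,Q)`-connected: it is `(r,Q)`-connected, and no proper subgraph of `G`
(with fewer edges, or fewer nodes; it still has to contain all the terminals, since the
requirements are on them) is.  A path of `H.spanningCoe` between two distinct nodes uses nodes
and edges of `H` only. -/
def IsMinimallyRQConnected (G : SimpleGraph V) (R : Set V) (r : Sym2 V → ℕ) (Q : Set V) : Prop :=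
  IsRQConnected G R r Q ∧
    ∀ H : G.Subgraph, R ⊆ H.verts → IsRQConnected H.spanningCoe R r Q → H = ⊤

/-! ### `R`-components -/

/-- The connected components of `G \ R`. -/
abbrev Comp (G : SimpleGraph V) (R : Set V) : Type _ :=
  (G.induce Rᶜ).ConnectedComponent

/-- The node set of a connected component of `G \ R`, as a set of nodes of `G`. -/
def Comp.nodes {G : SimpleGraph V} {R : Set V} (C : Comp G R) : Set V :=
  Subtype.val '' C.supp

/-- `Γ_G(C)`: the nodes outside `C` that have a neighbor in `C`. -/
def neighbors (G : SimpleGraph V) (C : Set V) : Set V :=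
  {v | v ∉ C ∧ ∃ u ∈ C, G.Adj u v}

/-- The `R`-component of a connected component `C` of `G \ R`: its node set is `C ∪ Γ_G(C)`, and
its edges are the edges of `G` with both endnodes, or exactly one endnode, in `C`. -/
def rComponent {G : SimpleGraph V} {R : Set V} (C : Comp G R) : G.Subgraph where
  verts := C.nodes ∪ neighbors G C.nodes
  Adj a b := G.Adj a b ∧ (a ∈ C.nodes ∨ b ∈ C.nodes)
  adj_sub h := h.1
  edge_vert := by
    rintro a b ⟨hab, h⟩
    by_cases ha : a ∈ C.nodes
    · exact Or.inl ha
    · exact Or.inr ⟨ha, b, h.resolve_left ha, hab.symm⟩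
  symm := ⟨fun _ _ h => ⟨h.1.symm, h.2.symm⟩⟩

/-! ### Fractional `(r,Q)`-connectivity: the cut-LP over bisets -/

/-- A biset: a pair of an inner part `X` and an outer part `X⁺` with `X ⊆ X⁺`. -/
structure Biset (V : Type*) where
  inner : Set V
  outer : Set V
  inner_subset : inner ⊆ outer

/-- The boundary `X⁺ \ X` of a biset. -/
def Biset.boundary (X : Biset V) : Set V := X.outer \ X.inner

/-- The edge `e` covers the biset: one endnode is in `X`, the other one outside `X⁺`. -/
def Biset.Covers (X : Biset V) (e : Sym2 V) : Prop :=
  ∃ u v, e = s(u, v) ∧ u ∈ X.inner ∧ v ∉ X.outer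

open Classical in
/-- The biset function `f` of the cut-LP: the largest requirement of a demand edge that covers the
biset (`0` if there is none) minus the size of the boundary if the boundary is contained in `Q`,
and `0` otherwise. -/
noncomputable def bisetRequirement [Fintype V] (R : Set V) (r : Sym2 V → ℕ) (Q : Set V)
    (X : Biset V) : ℝ :=
  if X.boundary ⊆ Q then
    (((Finset.univ.filter fun e => e ∈ demandEdges R r ∧ X.Covers e).sup r : ℕ) : ℝ)
      - (X.boundary.ncard : ℝ)
  else 0

open Classical in
/-- The graph `H` with edge capacities `x` is fractionally `(r,Q)`-connected: `x` is a feasible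
solution to the cut-LP. -/
def IsFractionallyRQConnected [Fintype V] (H : SimpleGraph V) (x : Sym2 V → ℝ)
    (R : Set V) (r : Sym2 V → ℕ) (Q : Set V) : Prop :=
  (∀ e ∈ H.edgeSet, 0 ≤ x e ∧ x e ≤ 1) ∧
    ∀ X : Biset V, bisetRequirement R r Q X ≤
      ∑ e ∈ Finset.univ.filter (fun e => e ∈ H.edgeSet ∧ X.Covers e), x e

/-! ### Replacing trees by DFS cycles -/

section Replace

variable {G : SimpleGraph V} {R : Set V}

/-- The non-terminal nodes of the `R`-components that are replaced. -/
def replacedNodes (S : Set (Comp G R)) : Set V := ⋃ C ∈ S, C.nodes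

open Classical in
/-- The number of copies of a node after the replacement: a non-terminal node `v` of a replaced
tree `T` gets `deg_T(v)` copies (all the edges of `G` at `v` are in `T`, so `deg_T(v)` is the
degree of `v` in `G`), every other node is kept as it is. -/
noncomputable def numCopies (S : Set (Comp G R)) (v : V) : ℕ :=
  if v ∈ replacedNodes S then (G.neighborSet v).ncard else 1

/-- The nodes of the new graph: pairs of a node `v` of `G` and the index of one of its copies. -/
abbrev NewNode (S : Set (Comp G R)) : Type _ := Σ v : V, Fin (numCopies S v)

/-- `D` is a DFS cycle of the tree `T`: it is a simple cycle through all the copies of the nodes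
of `T` that follows a depth first traversal of `T`, that is, the closed walk in `T` below it
traverses every edge of `T` exactly once in each of the two directions. -/
def IsDFSCycle (S : Set (Comp G R)) (T : G.Subgraph) (D : SimpleGraph (NewNode S)) : Prop :=
  ∃ (x : NewNode S) (p : D.Walk x x), p.IsCycle ∧
    (∀ e ∈ D.edgeSet, e ∈ p.edges) ∧
    (∀ y : NewNode S, y ∈ p.support ↔ y.1 ∈ T.verts) ∧
    (∀ d ∈ p.darts, T.Adj d.fst.1 d.snd.1) ∧
    (∀ a b : V, T.Adj a b → ∃! d : D.Dart, d ∈ p.darts ∧ d.fst.1 = a ∧ d.snd.1 = b)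

/-- The edges of `G` that do not belong to a replaced tree, that is, the edges without an endnode
in one of the chosen components. -/
def keptGraph (S : Set (Comp G R)) : SimpleGraph (NewNode S) where
  Adj x y := G.Adj x.1 y.1 ∧ x.1 ∉ replacedNodes S ∧ y.1 ∉ replacedNodes S
  symm := ⟨fun _ _ h => ⟨h.1.symm, h.2.2, h.2.1⟩⟩
  loopless := ⟨fun _ h => G.loopless.irrefl _ h.1⟩

/-- The graph obtained from `G` by replacing, for each `C ∈ S`, the `R`-component of `C` by the
cycle `D C`. -/
def replacedGraph (S : Set (Comp G R)) (D : Comp G R → SimpleGraph (NewNode S)) :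
    SimpleGraph (NewNode S) :=
  keptGraph S ⊔ ⨆ C ∈ S, D C

open Classical in
/-- The capacities: `1` on the edges of `G` that are kept, `1/2` on the edges of the cycles (no
edge of a DFS cycle is a kept edge, since it has an endnode over a chosen component). -/
noncomputable def replacedCapacity (S : Set (Comp G R)) (e : Sym2 (NewNode S)) : ℝ :=
  if e ∈ (keptGraph S).edgeSet then 1 else 1 / 2

/-- The copies of the nodes in `A`.  For `A = R` these are the terminals themselves, and for `Q`
every copy of a node of `Q` is in the new `Q`. -/
def copiesOf (S : Set (Comp G R)) (A : Set V) : Set (NewNode S) := {x | x.1 ∈ A}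

/-- The requirements on the new graph: those of `r`, read on the underlying nodes. -/
def liftRequirement (S : Set (Comp G R)) (r : Sym2 V → ℕ) (e : Sym2 (NewNode S)) : ℕ :=
  r (e.map Sigma.fst)

end Replace

end SurvivableNetwork

namespace SurvivableNetwork

/-! ### Two disjoint walks between sets of nodes -/

section Menger

variable {W : Type*}

/-! By Menger's theorem, a pair with requirement 2 is served exactly when no single item, meaning an
edge or a node of `Q` other than the pair, separates it (`TwoConn`). Minimality then says of each
edge `xy` that it is a bridge between two terminals, or that together with some item it separates a
2-connected pair of terminals (`EdgeNeeded`). All structure comes from this.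

The engine is `not_twoConn_outside_segment`: a path or cycle with inner nodes outside `R` cannot
have its ends joined robustly, against every item, outside the segment. Neededness of the first edge
of such a segment yields a component hanging on two inner nodes, and the part of the segment between
them is a shorter segment of the same kind. A cycle with at most one terminal is such a segment with
equal ends, so there is none, and the `R`-components are trees. A second consequence,
`TwoConn.reachable_off_path`, is that deleting a path of nodes of `Q` whose nodes, except possibly
the first, are non-terminals never separates a 2-connected pair.

For the fractional statement, a DFS cycle without boundary nodes crosses a cut an even number of
times. A violated cut without kept edges and of requirement 2 therefore consists, in the critical
cases, of two edges of one cycle (empty boundary), or of one edge of a cycle whose tree contains the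
boundary node `q`. A path in the tree meets both edges, or contains `q` and meets the edge. Deleting
it leaves the pair connected in `G`, and `IsDFSCycle.same_side` carries this connection to the new
graph: the part of the tree on one side of a single attaching edge is entered by the cycle only
once, so two copies over it are joined by an arc staying over it. Hence the pair is not separated
after all. The other cuts follow from parity, or from deleting a single edge or node. -/

lemma exists_walk_avoiding_of_separator {H : SimpleGraph W} {A B : Set W} {s x y : W}
    (hno : ∀ a ∈ A, ∀ b ∈ B, ∀ p : (H.deleteEdges {s(x, y)}).Walk a b, s ∈ p.support)
    (hx : ∃ a ∈ A, ∃ p : (H.deleteEdges {s(x, y)}).Walk a x, s ∉ p.support)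
    (hy : ∃ b ∈ B, ∃ p : (H.deleteEdges {s(x, y)}).Walk b y, s ∉ p.support)
    (h : ∀ w, ∃ a ∈ A, ∃ b ∈ B, ∃ p : H.Walk a b, w ∉ p.support) (w : W) :
    ∃ a ∈ A, ∃ b ∈ ({s, x} : Set W), ∃ p : (H.deleteEdges {s(x, y)}).Walk a b,
      w ∉ p.support := by
  classical
  by_cases hws : w = s
  · subst hws
    obtain ⟨a, ha, p, hp⟩ := hx
    exact ⟨a, ha, x, by simp, p, hp⟩
  -- Suppose `w` meets every walk from `A` to `{s, x}` without the edge `xy`. The set `U` reached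
  -- from `A` around `w` then contains neither end of `xy` and no node of `B`, so a walk of `H`
  -- around `w` could not leave `U`.
  by_contra hcon
  push Not at hcon
  obtain ⟨a, ha, b, hb, p, hp⟩ := h w
  let U : Set W := {z | ∃ a ∈ A, ∃ q : (H.deleteEdges {s(x, y)}).Walk a z, w ∉ q.support}
  have hUs : ∀ z, ∀ a ∈ A, ∀ q : (H.deleteEdges {s(x, y)}).Walk a z, w ∉ q.support →
      s ∉ q.support := by
    intro z a ha q hq hs
    exact hq (q.support_takeUntil_subset_support hs (hcon a ha s (by simp) (q.takeUntil s hs)))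
  have haU : a ∈ U := ⟨a, ha, .nil, by
    intro hw
    simp only [SimpleGraph.Walk.support_nil, List.mem_singleton] at hw
    exact hp (hw ▸ p.start_mem_support)⟩
  have hbU : b ∉ U := by
    rintro ⟨a', ha', q, hq⟩
    exact hUs _ a' ha' q hq (hno a' ha' b hb q)
  have hxU : x ∉ U := by
    rintro ⟨a', ha', q, hq⟩
    exact hq (hcon a' ha' x (by simp) q)
  have hyU : y ∉ U := by
    rintro ⟨a', ha', q, hq⟩
    obtain ⟨b', hb', q', hq'⟩ := hy
    have := hno a' ha' b' hb' (q.append q'.reverse)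
    rw [SimpleGraph.Walk.mem_support_append_iff, SimpleGraph.Walk.support_reverse,
      List.mem_reverse] at this
    exact this.elim (hUs _ a' ha' q hq) hq'
  obtain ⟨d, hd, hdU, hdU'⟩ := p.exists_boundary_dart U haU hbU
  have hde : d.edge ≠ s(x, y) := by
    intro he
    rcases SimpleGraph.dart_edge_eq_mk'_iff'.1 he with ⟨h1, _⟩ | ⟨h1, _⟩
    · exact hxU (h1 ▸ hdU)
    · exact hyU (h1 ▸ hdU)
  obtain ⟨a', ha', q, hq⟩ := hdU
  refine hdU' ⟨a', ha', q.concat (SimpleGraph.deleteEdges_adj.2 ⟨d.adj, hde⟩), ?_⟩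
  rw [SimpleGraph.Walk.support_concat, List.mem_append, List.mem_singleton]
  rintro (h1 | h1)
  · exact hq h1
  · exact hp (h1 ▸ p.dart_snd_mem_support_of_mem_darts hd)

/-- The walk around `s` has to use `xy`. Looking at where it first leaves the part reachable around
`s`, once from each end, orients the edge; both looks cannot give the same endnode, since that would
join `A` to `B` around `s` without `xy`. -/
lemma exists_edge_of_separator {H : SimpleGraph W} {A B : Set W} {s x y : W}
    (hno : ∀ a ∈ A, ∀ b ∈ B, ∀ p : (H.deleteEdges {s(x, y)}).Walk a b, s ∈ p.support)
    (h : ∃ a ∈ A, ∃ b ∈ B, ∃ p : H.Walk a b, s ∉ p.support) :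
    ∃ x' y', s(x', y') = s(x, y) ∧
      (∃ a ∈ A, ∃ p : (H.deleteEdges {s(x, y)}).Walk a x', s ∉ p.support) ∧
      (∃ b ∈ B, ∃ p : (H.deleteEdges {s(x, y)}).Walk b y', s ∉ p.support) := by
  obtain ⟨a, ha, b, hb, p, hp⟩ := h
  have key : ∀ {A : Set W} {a b : W} (ha : a ∈ A) (p : H.Walk a b) (hp : s ∉ p.support)
      (hb : ∀ a ∈ A, ∀ q : (H.deleteEdges {s(x, y)}).Walk a b, s ∈ q.support),
      ∃ d ∈ p.darts, d.edge = s(x, y) ∧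
        ∃ a ∈ A, ∃ p : (H.deleteEdges {s(x, y)}).Walk a d.fst, s ∉ p.support := by
    intro A a b ha p hp hb
    let U : Set W := {z | ∃ a ∈ A, ∃ q : (H.deleteEdges {s(x, y)}).Walk a z, s ∉ q.support}
    have haU : a ∈ U := ⟨a, ha, .nil, by
      intro hw
      simp only [SimpleGraph.Walk.support_nil, List.mem_singleton] at hw
      exact hp (hw ▸ p.start_mem_support)⟩
    have hbU : b ∉ U := by
      rintro ⟨a', ha', q, hq⟩
      exact hq (hb a' ha' q)
    obtain ⟨d, hd, hdU, hdU'⟩ := p.exists_boundary_dart U haU hbU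
    refine ⟨d, hd, ?_, hdU⟩
    by_contra hde
    obtain ⟨a', ha', q, hq⟩ := hdU
    refine hdU' ⟨a', ha', q.concat (SimpleGraph.deleteEdges_adj.2 ⟨d.adj, hde⟩), ?_⟩
    rw [SimpleGraph.Walk.support_concat, List.mem_append, List.mem_singleton]
    rintro (h1 | h1)
    · exact hq h1
    · exact hp (h1 ▸ p.dart_snd_mem_support_of_mem_darts hd)
  obtain ⟨d, -, hde, hdA⟩ := key ha p hp (fun a ha q => hno a ha b hb q)
  obtain ⟨d', -, hde', hdB⟩ := key hb p.reverse (by simpa using hp) (fun b hb q => by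
    simpa using hno a ha b hb q.reverse)
  have hne : d'.fst ≠ d.fst := by
    intro heq
    obtain ⟨a', ha', q, hq⟩ := hdA
    rw [heq] at hdB
    obtain ⟨b', hb', q', hq'⟩ := hdB
    have := hno a' ha' b' hb' (q.append q'.reverse)
    rw [SimpleGraph.Walk.mem_support_append_iff, SimpleGraph.Walk.support_reverse,
      List.mem_reverse] at this
    exact this.elim hq hq'
  refine ⟨d.fst, d'.fst, ?_, hdA, hdB⟩
  rcases SimpleGraph.dart_edge_eq_mk'_iff'.1 hde with ⟨h1, h2⟩ | ⟨h1, h2⟩ <;>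
  rcases SimpleGraph.dart_edge_eq_mk'_iff'.1 hde' with ⟨h3, h4⟩ | ⟨h3, h4⟩ <;>
  simp_all [Sym2.eq_swap]

/-- The vertex version of Menger's theorem for two walks: if no node separates `A` from `B`, then
there are two disjoint paths from `A` to `B`. -/
theorem exists_two_disjoint_paths [Finite W] [Nonempty W] (H : SimpleGraph W) (A B : Set W)
    (h : ∀ w, ∃ a ∈ A, ∃ b ∈ B, ∃ p : H.Walk a b, w ∉ p.support) :
    ∃ a ∈ A, ∃ b ∈ B, ∃ a' ∈ A, ∃ b' ∈ B, ∃ p : H.Walk a b, ∃ p' : H.Walk a' b',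
      p.IsPath ∧ p'.IsPath ∧ ∀ w ∈ p.support, w ∉ p'.support := by
  classical
  induction hn : H.edgeSet.ncard using Nat.strong_induction_on generalizing H A B with
  | _ n ih =>
  by_cases hbot : H = ⊥
  · subst hbot
    have hAB : ∀ w, ∃ a ∈ A, a ∈ B ∧ w ≠ a := by
      intro w
      obtain ⟨a, ha, b, hb, p, hp⟩ := h w
      cases p with
      | nil => exact ⟨a, ha, hb, by simpa using hp⟩
      | cons hadj _ => exact hadj.elim
    obtain ⟨a, ha, hab, -⟩ := hAB (Classical.arbitrary W)
    obtain ⟨a', ha', hab', hne⟩ := hAB a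
    exact ⟨a, ha, a, hab, a', ha', a', hab', .nil, .nil, .nil, .nil, by simpa using hne⟩
  obtain ⟨x₀, y₀, hxy₀⟩ := SimpleGraph.ne_bot_iff_exists_adj.1 hbot
  have hlt : ∀ x y, s(x, y) = s(x₀, y₀) → (H.deleteEdges {s(x, y)}).edgeSet.ncard < n := by
    intro x y he
    rw [← hn, he]
    refine Set.ncard_lt_ncard ?_ (Set.toFinite _)
    rw [SimpleGraph.edgeSet_deleteEdges]
    exact Set.sdiff_singleton_ssubset.2 hxy₀
  by_cases hall : ∀ w, ∃ a ∈ A, ∃ b ∈ B, ∃ p : (H.deleteEdges {s(x₀, y₀)}).Walk a b,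
      w ∉ p.support
  · obtain ⟨a, ha, b, hb, a', ha', b', hb', p, p', hp, hp', hd⟩ :=
      ih _ (hlt _ _ rfl) _ A B hall rfl
    refine ⟨a, ha, b, hb, a', ha', b', hb', p.mapLe (SimpleGraph.deleteEdges_le _),
      p'.mapLe (SimpleGraph.deleteEdges_le _), hp.mapLe _, hp'.mapLe _, ?_⟩
    simpa using hd
  push Not at hall
  obtain ⟨s, hno⟩ := hall
  obtain ⟨x, y, hxy, hx, hy⟩ := exists_edge_of_separator hno (h s)
  rw [← hxy] at hno hx hy
  have hadj : H.Adj x y := by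
    rw [← SimpleGraph.mem_edgeSet, hxy]; exact hxy₀
  -- Since `s` separates `A` from `B` without the edge `xy`, the induction hypothesis is applied to
  -- `A, {s, x}` and to `B, {s, y}`. The resulting paths are glued at `s` and along `xy`; a path
  -- from `A` meets one from `B` at most in `s`, again because `s` separates.
  have hA := exists_walk_avoiding_of_separator hno hx hy h
  have hB := exists_walk_avoiding_of_separator (H := H) (A := B) (B := A) (s := s) (x := y) (y := x)
    (by
      rw [Sym2.eq_swap]
      intro b hb a ha p
      simpa using hno a ha b hb p.reverse) (by rwa [Sym2.eq_swap]) (by rwa [Sym2.eq_swap])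
    (fun w => by
      obtain ⟨a, ha, b, hb, p, hp⟩ := h w
      exact ⟨b, hb, a, ha, p.reverse, by simpa using hp⟩)
  rw [Sym2.eq_swap] at hB
  have split : ∀ (A : Set W) (x : W),
      (∃ a ∈ A, ∃ b ∈ ({s, x} : Set W), ∃ a' ∈ A, ∃ b' ∈ ({s, x} : Set W),
        ∃ p : (H.deleteEdges {s(x₀, y₀)}).Walk a b, ∃ p' : (H.deleteEdges {s(x₀, y₀)}).Walk a' b',
        p.IsPath ∧ p'.IsPath ∧ ∀ w ∈ p.support, w ∉ p'.support) →
      ∃ a ∈ A, ∃ a' ∈ A, ∃ p : (H.deleteEdges {s(x₀, y₀)}).Walk a s,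
        ∃ p' : (H.deleteEdges {s(x₀, y₀)}).Walk a' x,
        p.IsPath ∧ p'.IsPath ∧ ∀ w ∈ p.support, w ∉ p'.support := by
    rintro A x ⟨a, ha, b, hb, a', ha', b', hb', p, p', hp, hp', hd⟩
    rcases hb with rfl | rfl <;> rcases hb' with rfl | rfl
    · exact (hd _ p.end_mem_support p'.end_mem_support).elim
    · exact ⟨a, ha, a', ha', p, p', hp, hp', hd⟩
    · exact ⟨a', ha', a, ha, p', p, hp', hp, fun w h1 h2 => hd w h2 h1⟩
    · exact (hd _ p.end_mem_support p'.end_mem_support).elim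
  have hA' := ih _ (hlt x y hxy) _ A _ hA rfl
  have hB' := ih _ (hlt x y hxy) _ B _ hB rfl
  rw [hxy] at hA' hB' hno
  obtain ⟨a₁, ha₁, a₂, ha₂, p₁, p₂, hp₁, hp₂, hp⟩ := split A x hA'
  obtain ⟨b₁, hb₁, b₂, hb₂, q₁, q₂, hq₁, hq₂, hq⟩ := split B y hB'
  have hle : H.deleteEdges {s(x₀, y₀)} ≤ H := SimpleGraph.deleteEdges_le _
  have hsp₂ : s ∉ p₂.support := hp _ p₁.end_mem_support
  have hsq₂ : s ∉ q₂.support := hq _ q₁.end_mem_support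
  have hcross : ∀ {a b z : W} (_ : a ∈ A) (_ : b ∈ B) (p : (H.deleteEdges {s(x₀, y₀)}).Walk a z)
      (q : (H.deleteEdges {s(x₀, y₀)}).Walk b z), s ∉ p.support → s ∉ q.support → False := by
    intro a b z ha hb p q hp hq
    have := hno a ha b hb (p.append q.reverse)
    rw [SimpleGraph.Walk.mem_support_append_iff, SimpleGraph.Walk.support_reverse,
      List.mem_reverse] at this
    exact this.elim hp hq
  have havoid : ∀ {a x z : W} (p : (H.deleteEdges {s(x₀, y₀)}).Walk a x) (hz : z ∈ p.support),
      s ∉ p.support → s ∉ (p.takeUntil z hz).support := fun p hz hs h1 =>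
    hs (p.support_takeUntil_subset_support hz h1)
  let P := (p₁.append q₁.reverse).mapLe hle
  let P' := (p₂.mapLe hle).append (.cons hadj (q₂.reverse.mapLe hle))
  have hPP : ∀ w ∈ P.support, w ∉ P'.support := by
    intro w hw hw'
    simp only [P, P', SimpleGraph.Walk.support_mapLe_eq_support, SimpleGraph.Walk.mem_support_append_iff,
      SimpleGraph.Walk.support_reverse, List.mem_reverse, SimpleGraph.Walk.support_cons,
      List.mem_cons] at hw hw'
    have hw'' : w ∈ p₂.support ∨ w ∈ q₂.support := by
      rcases hw' with h1 | rfl | h1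
      · exact .inl h1
      · exact .inl p₂.end_mem_support
      · exact .inr h1
    have hws : w ≠ s := by
      rintro rfl
      exact hw''.elim hsp₂ hsq₂
    rcases hw with h1 | h1 <;> rcases hw'' with h2 | h2
    · exact hp w h1 h2
    · exact hcross ha₁ hb₂ (p₁.takeUntil w h1) (q₂.takeUntil w h2)
        (SimpleGraph.Walk.endpoint_notMem_support_takeUntil hp₁ h1 hws.symm) (havoid _ _ hsq₂)
    · exact hcross ha₂ hb₁ (p₂.takeUntil w h2) (q₁.takeUntil w h1) (havoid _ _ hsp₂)
        (SimpleGraph.Walk.endpoint_notMem_support_takeUntil hq₁ h1 hws.symm)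
    · exact hq w h1 h2
  exact ⟨a₁, ha₁, b₁, hb₁, a₂, ha₂, b₂, hb₂, P.bypass, P'.bypass, P.bypass_isPath,
    P'.bypass_isPath, fun w hw hw' => hPP w (P.support_bypass_subset_support hw)
      (P'.support_bypass_subset_support hw')⟩

end Menger

/-! ### Cuts by one item -/

section Items

variable {V : Type*}

/-- The edge sets whose removal amounts to the removal of one edge, or of one node of `Q` other
than `u` and `v`. -/
def IsItem (Q : Set V) (u v : V) (F : Set (Sym2 V)) : Prop :=
  (∃ f, F = {f}) ∨ ∃ q ∈ Q, q ≠ u ∧ q ≠ v ∧ F = {e | q ∈ e}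

/-- No single edge, and no single node of `Q` other than `u` and `v`, separates `u` from `v`. -/
def TwoConn (G : SimpleGraph V) (Q : Set V) (u v : V) : Prop :=
  ∀ F, IsItem Q u v F → (G.deleteEdges F).Reachable u v

lemma IsItem.symm {Q : Set V} {u v : V} {F : Set (Sym2 V)} (h : IsItem Q u v F) :
    IsItem Q v u F := by
  rcases h with h | ⟨q, hq, h1, h2, h3⟩
  · exact .inl h
  · exact .inr ⟨q, hq, h2, h1, h3⟩

lemma TwoConn.symm {G : SimpleGraph V} {Q : Set V} {u v : V} (h : TwoConn G Q u v) :
    TwoConn G Q v u := fun F hF => (h F hF.symm).symm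

/-- The item `α`, an edge of `G` or a node, touches the node `w`. -/
def Touches (G : SimpleGraph V) : Sym2 V ⊕ V → V → Prop
  | .inl e, w => e ∈ G.edgeSet ∧ w ∈ e
  | .inr q, w => w = q

/-- Two items are adjacent if a walk that uses one of them can use the other one next: they touch
a common node, which has to be one of the two items if it is in `N`. -/
def itemGraph (G : SimpleGraph V) (N : Set V) : SimpleGraph (Sym2 V ⊕ V) where
  Adj α β := α ≠ β ∧ ∃ w, Touches G α w ∧ Touches G β w ∧ (w ∈ N → α = .inr w ∨ β = .inr w)
  symm := ⟨fun _ _ h => ⟨h.1.symm, h.2.imp fun _ h => ⟨h.2.1, h.1, fun hw => (h.2.2 hw).symm⟩⟩⟩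
  loopless := ⟨fun _ h => h.1 rfl⟩

/-- A walk of `G` becomes a walk through the items it uses. The two conditions on `i` say that `i`
is none of the items available to a walk that avoids `F`, so the translated walk avoids `i`. -/
lemma exists_itemGraph_walk {G : SimpleGraph V} {N : Set V} {F : Set (Sym2 V)} {u v : V}
    (huv : u ≠ v) (h : (G.deleteEdges F).Reachable u v) (i : Sym2 V ⊕ V)
    (hi : ∀ e, e ∉ F → i ≠ .inl e) (hi' : ∀ w ∈ N, ∀ e, w ∈ e → e ∉ F → i ≠ .inr w) :
    ∃ α ∈ {α | Touches G α u}, ∃ β ∈ {β | Touches G β v}, ∃ p : (itemGraph G N).Walk α β,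
      i ∉ p.support := by
  classical
  obtain ⟨p⟩ := h
  let U : Set V := {w | w = u ∨ ∃ α ∈ {α | Touches G α u}, ∃ β ∈ {β | Touches G β w},
    ∃ p : (itemGraph G N).Walk α β, i ∉ p.support}
  by_contra hcon
  have hvU : v ∉ U := by
    rintro (h | h)
    · exact huv h.symm
    · exact hcon h
  obtain ⟨d, -, hdU, hdU'⟩ := p.exists_boundary_dart U (.inl rfl) hvU
  obtain ⟨hadj, hF⟩ := SimpleGraph.deleteEdges_adj.1 d.adj
  have hie := hi _ hF
  have t1 : Touches G (.inl s(d.fst, d.snd)) d.fst := ⟨hadj, by simp⟩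
  have t2 : Touches G (.inl s(d.fst, d.snd)) d.snd := ⟨hadj, by simp⟩
  refine hdU' (.inr ?_)
  rcases hdU with h | ⟨α, hα, β, hβ, p, hp⟩
  · refine ⟨.inl s(d.fst, d.snd), h ▸ t1, .inl s(d.fst, d.snd), t2, .nil, ?_⟩
    simpa using hie
  by_cases hβe : β = .inl s(d.fst, d.snd)
  · exact ⟨α, hα, β, hβe ▸ t2, p, hp⟩
  -- At a node of `N` the next edge item is not adjacent to the current one, unless the current item
  -- is that node; the node item is inserted in between.
  by_cases hN : d.fst ∈ N ∧ β ≠ .inr d.fst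
  · have hi2 := hi' _ hN.1 _ (Sym2.mem_mk_left _ _) hF
    have a1 : (itemGraph G N).Adj β (.inr d.fst) := ⟨hN.2, d.fst, hβ, rfl, fun _ => .inr rfl⟩
    have a2 : (itemGraph G N).Adj (.inr d.fst) (.inl s(d.fst, d.snd)) :=
      ⟨by simp, d.fst, rfl, t1, fun _ => .inl rfl⟩
    refine ⟨α, hα, _, t2, (p.concat a1).concat a2, ?_⟩
    simp only [SimpleGraph.Walk.support_concat, List.mem_append, List.mem_singleton]
    tauto
  · have a1 : (itemGraph G N).Adj β (.inl s(d.fst, d.snd)) :=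
      ⟨hβe, d.fst, hβ, t1, fun h => .inl (by tauto)⟩
    refine ⟨α, hα, _, t2, p.concat a1, ?_⟩
    simp only [SimpleGraph.Walk.support_concat, List.mem_append, List.mem_singleton]
    tauto

/-- There is a walk from `u` to `z` that uses only edges, and only nodes of `N`, among the items
`S`. -/
def WalkIn (G : SimpleGraph V) (N : Set V) (S : Set (Sym2 V ⊕ V)) (u z : V) : Prop :=
  ∃ g : G.Walk u z, (∀ e ∈ g.edges, .inl e ∈ S) ∧ ∀ w ∈ g.support, w ∈ N → .inr w ∈ S

lemma WalkIn.step {G : SimpleGraph V} {N : Set V} {S : Set (Sym2 V ⊕ V)} {u z w : V}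
    (h : WalkIn G N S u z) {α : Sym2 V ⊕ V} (hα : α ∈ S) (hz : Touches G α z)
    (hw : Touches G α w) (hwN : w ∈ N → .inr w ∈ S) : WalkIn G N S u w := by
  by_cases hzw : z = w
  · exact hzw ▸ h
  cases α with
  | inr q => exact (hzw (Eq.trans hz (Eq.symm hw))).elim
  | inl e =>
    have he : e = s(z, w) := (Sym2.mem_and_mem_iff hzw).1 ⟨hz.2, hw.2⟩
    subst he
    have hadj : G.Adj z w := hz.1
    obtain ⟨g, h1, h2⟩ := h
    refine ⟨g.concat hadj, ?_, ?_⟩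
    · intro e he
      rw [SimpleGraph.Walk.edges_concat, List.concat_eq_append, List.mem_append,
        List.mem_singleton] at he
      rcases he with he | rfl
      · exact h1 e he
      · exact hα
    · intro w' hw' hN
      rw [SimpleGraph.Walk.support_concat, List.mem_append, List.mem_singleton] at hw'
      rcases hw' with he | rfl
      · exact h2 _ he hN
      · exact hwN hN

lemma WalkIn.of_itemGraph_walk {G : SimpleGraph V} {N : Set V} {S : Set (Sym2 V ⊕ V)} {u : V}
    {α β : Sym2 V ⊕ V} (p : (itemGraph G N).Walk α β) (hS : ∀ γ ∈ p.support, γ ∈ S) {z : V}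
    (h : WalkIn G N S u z) (hz : Touches G α z) : ∃ z', WalkIn G N S u z' ∧ Touches G β z' := by
  revert hS
  induction p generalizing z with
  | nil => exact fun _ => ⟨z, h, hz⟩
  | @cons α γ β hadj p ih =>
    intro hS
    obtain ⟨w, hαw, hγw, hw⟩ := hadj.2
    have hα : α ∈ S := hS _ (by simp)
    have hγ : γ ∈ S := hS _ (by simp)
    refine ih (h.step hα hz hαw ?_) hγw fun γ hγ => hS _ (by simp [hγ])
    intro hwN
    rcases hw hwN with rfl | rfl
    · exact hα
    · exact hγ

/-- Menger's theorem for two paths that share no edge and no node of `Q`. -/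
theorem TwoConn.hasDisjointPaths [Finite V] {G : SimpleGraph V} {Q : Set V} {u v : V}
    (h : TwoConn G Q u v) (huv : u ≠ v) : HasDisjointPaths G Q u v 2 := by
  classical
  let N : Set V := {w | w ∈ Q ∧ w ≠ u ∧ w ≠ v}
  have : Nonempty (Sym2 V ⊕ V) := ⟨.inr u⟩
  obtain ⟨a, ha, b, hb, a', ha', b', hb', p, p', -, -, hd⟩ :=
    exists_two_disjoint_paths (itemGraph G N) {α | Touches G α u} {β | Touches G β v} (by
      rintro (f | q)
      · refine exists_itemGraph_walk huv (h {f} (.inl ⟨f, rfl⟩)) _ ?_ ?_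
        · rintro e he h
          exact he (Sum.inl.inj h).symm
        · simp
      · by_cases hq : q ∈ N
        · refine exists_itemGraph_walk huv (h _ (.inr ⟨q, hq.1, hq.2.1, hq.2.2, rfl⟩)) _
            (by simp) ?_
          rintro w - e hwe he heq
          exact he (by rwa [← Sum.inr.inj heq] at hwe)
        -- Here `q` is not an item that a walk ever needs, so nothing has to be removed: deleting
        -- the loop `s(u, u)` does not change `G`.
        · refine exists_itemGraph_walk huv (h {s(u, u)} (.inl ⟨_, rfl⟩)) _ (by simp) ?_
          rintro w hw e - - heq
          exact hq (by rwa [← Sum.inr.inj heq] at hw))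
  have key : ∀ {a b : Sym2 V ⊕ V} (p : (itemGraph G N).Walk a b), Touches G a u →
      Touches G b v → WalkIn G N {γ | γ ∈ p.support} u v := by
    intro a b p ha hb
    have hu : WalkIn G N {γ | γ ∈ p.support} u u := by
      refine ⟨.nil, by simp, ?_⟩
      intro w hw hwN
      simp only [SimpleGraph.Walk.support_nil, List.mem_singleton] at hw
      exact (hwN.2.1 hw).elim
    obtain ⟨z, hz, hbz⟩ := WalkIn.of_itemGraph_walk p (fun _ h => h) hu ha
    exact hz.step p.end_mem_support hbz hb fun h => (h.2.2 rfl).elim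
  obtain ⟨g, h1, h2⟩ := key p ha hb
  obtain ⟨g', h1', h2'⟩ := key p' ha' hb'
  have e1 : ∀ e, e ∈ g.toPath.1.edges → e ∉ g'.toPath.1.edges := fun e he he' =>
    hd _ (h1 e (g.edges_bypass_subset_edges he)) (h1' e (g'.edges_bypass_subset_edges he'))
  have e2 : ∀ w, w ∈ Q → w ≠ u → w ≠ v → w ∈ g.toPath.1.support → w ∉ g'.toPath.1.support :=
    fun w hQ hu hv hw hw' => hd _ (h2 w (g.support_bypass_subset_support hw) ⟨hQ, hu, hv⟩)
      (h2' w (g'.support_bypass_subset_support hw') ⟨hQ, hu, hv⟩)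
  refine ⟨![g.toPath, g'.toPath], ?_⟩
  intro i j hij
  fin_cases i <;> fin_cases j
  · exact (hij rfl).elim
  · exact ⟨e1, e2⟩
  · exact ⟨fun e he he' => e1 e he' he, fun w hQ hu hv hw hw' => e2 w hQ hu hv hw' hw⟩
  · exact (hij rfl).elim

lemma reachable_deleteEdges_of_walk {G : SimpleGraph V} {F : Set (Sym2 V)} {u v : V}
    (p : G.Walk u v) (h : ∀ e ∈ p.edges, e ∉ F) : (G.deleteEdges F).Reachable u v :=
  ⟨p.toDeleteEdges F h⟩

lemma HasDisjointPaths.twoConn {G : SimpleGraph V} {Q : Set V} {u v : V}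
    (h : HasDisjointPaths G Q u v 2) : TwoConn G Q u v := by
  obtain ⟨P, hP⟩ := h
  obtain ⟨h1, h2⟩ := hP 0 1 (by simp)
  rintro F (⟨f, rfl⟩ | ⟨q, hq, hqu, hqv, rfl⟩)
  · by_cases hf : f ∈ (P 0 : G.Walk u v).edges
    · exact reachable_deleteEdges_of_walk (P 1).1 fun e he hef => h1 f hf (hef ▸ he)
    · exact reachable_deleteEdges_of_walk (P 0).1 fun e he hef => hf (hef ▸ he)
  · by_cases hf : q ∈ (P 0 : G.Walk u v).support
    · exact reachable_deleteEdges_of_walk (P 1).1 fun e he hef =>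
        h2 q hq hqu hqv hf (SimpleGraph.Walk.mem_support_of_mem_edges he hef)
    · exact reachable_deleteEdges_of_walk (P 0).1 fun e he hef =>
        hf (SimpleGraph.Walk.mem_support_of_mem_edges he hef)

lemma HasDisjointPaths.mono {G : SimpleGraph V} {Q : Set V} {u v : V} {k l : ℕ} (hkl : k ≤ l)
    (h : HasDisjointPaths G Q u v l) : HasDisjointPaths G Q u v k := by
  obtain ⟨P, hP⟩ := h
  exact ⟨fun i => P (Fin.castLE hkl i), fun i j hij =>
    hP _ _ fun h => hij (Fin.castLE_injective hkl h)⟩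

lemma le_qConnectivity_iff {G : SimpleGraph V} {Q : Set V} {u v : V} {k : ℕ} :
    (k : ℕ∞) ≤ qConnectivity G Q u v ↔ HasDisjointPaths G Q u v k := by
  constructor
  · intro h
    cases k with
    | zero => exact ⟨fun i => i.elim0, fun i => i.elim0⟩
    | succ k =>
      have hlt : (k : ℕ∞) < qConnectivity G Q u v :=
        lt_of_lt_of_le (by exact_mod_cast Nat.lt_succ_self k) h
      rw [qConnectivity, lt_iSup_iff] at hlt
      obtain ⟨l, hl⟩ := hlt
      rw [lt_iSup_iff] at hl
      obtain ⟨hl, hkl⟩ := hl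
      exact hl.mono (by exact_mod_cast hkl)
  · intro h
    exact le_iSup₂_of_le k h le_rfl

lemma hasDisjointPaths_one_iff {G : SimpleGraph V} {Q : Set V} {u v : V} :
    HasDisjointPaths G Q u v 1 ↔ G.Reachable u v := by
  classical
  constructor
  · rintro ⟨P, -⟩
    exact ⟨(P 0).1⟩
  · rintro ⟨p⟩
    exact ⟨fun _ => p.toPath, fun i j hij => (hij (Subsingleton.elim i j)).elim⟩

end Items

/-! ### Minimally connected graphs -/

section Minimal

variable {V : Type*} {G : SimpleGraph V} {R Q : Set V} {r : Sym2 V → ℕ}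

lemma IsRQConnected.reachable (h : IsRQConnected G R r Q) {u v : V}
    (huv : s(u, v) ∈ demandEdges R r) : G.Reachable u v := by
  refine hasDisjointPaths_one_iff.1 (HasDisjointPaths.mono (Q := Q) ?_
    (le_qConnectivity_iff.1 (h u v huv)))
  exact huv.2.2

lemma IsRQConnected.twoConn (h : IsRQConnected G R r Q) {u v : V}
    (huv : s(u, v) ∈ demandEdges R r) (hr : r s(u, v) = 2) : TwoConn G Q u v := by
  have := le_qConnectivity_iff.1 (h u v huv)
  rw [hr] at this
  exact this.twoConn

/-- What the minimality says about a single edge `xy`. -/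
def EdgeNeeded (G : SimpleGraph V) (R Q : Set V) (x y : V) : Prop :=
  ∃ s ∈ R, ∃ t ∈ R, s ≠ t ∧
    ((G.Reachable s t ∧ ¬ (G.deleteEdges {s(x, y)}).Reachable s t) ∨
      (TwoConn G Q s t ∧ ∃ F, IsItem Q s t F ∧
        ¬ (G.deleteEdges ({s(x, y)} ∪ F)).Reachable s t))

/-- Deleting `xy` violates some demand. With requirement 1 its pair becomes disconnected; with
requirement 2, Menger's theorem in the graph without `xy` provides a separating item. -/
lemma IsMinimallyRQConnected.edgeNeeded [Finite V]
    (hr : ∀ u ∈ R, ∀ v ∈ R, u ≠ v → r s(u, v) ∈ ({0, 1, 2} : Set ℕ))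
    (hG : IsMinimallyRQConnected G R r Q) {x y : V} (hxy : G.Adj x y) : EdgeNeeded G R Q x y := by
  classical
  let H : G.Subgraph := (⊤ : G.Subgraph).deleteEdges {s(x, y)}
  have hH : H.spanningCoe = G.deleteEdges {s(x, y)} := by
    ext a b
    simp [H]
  have hne : H ≠ ⊤ := by
    intro h
    have : H.Adj x y := by rw [h]; exact hxy
    simp [H] at this
  have hnot : ¬ IsRQConnected (G.deleteEdges {s(x, y)}) R r Q := by
    intro h
    exact hne (hG.2 H (by simp [H]) (hH ▸ h))
  unfold IsRQConnected at hnot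
  push Not at hnot
  obtain ⟨s, t, hst, hlt⟩ := hnot
  have hs : s ∈ R := hst.2.1 s (by simp)
  have ht : t ∈ R := hst.2.1 t (by simp)
  have hne : s ≠ t := fun h => hst.1 (by simpa using h)
  have hnd := fun h => hlt.not_ge ((le_qConnectivity_iff (k := r s(s, t))).2 h)
  refine ⟨s, hs, t, ht, hne, ?_⟩
  rcases hr s hs t ht hne with h0 | h1 | h2
  · exact (hst.2.2.ne' h0).elim
  · rw [h1, hasDisjointPaths_one_iff] at hnd
    exact .inl ⟨hG.1.reachable hst, hnd⟩
  · rw [Set.mem_singleton_iff] at h2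
    right
    rw [h2] at hnd
    refine ⟨hG.1.twoConn hst h2, ?_⟩
    have : ¬ TwoConn (G.deleteEdges {s(x, y)}) Q s t := fun h => hnd (h.hasDisjointPaths hne)
    unfold TwoConn at this
    push Not at this
    obtain ⟨F, hF, hFn⟩ := this
    exact ⟨F, hF, by rwa [SimpleGraph.deleteEdges_deleteEdges] at hFn⟩

end Minimal

/-! ### Reachability after deleting edges or nodes -/

section Reach

variable {V : Type*} {G : SimpleGraph V} {Q R : Set V}

/-- The edges with an endnode in `A`: deleting them amounts to deleting the nodes `A`. -/
def touching (A : Set V) : Set (Sym2 V) := {e | ∃ a ∈ A, a ∈ e}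

lemma reachable_deleteEdges_mono {F F' : Set (Sym2 V)} (h : F' ⊆ F) {u v : V}
    (huv : (G.deleteEdges F).Reachable u v) : (G.deleteEdges F').Reachable u v :=
  huv.mono (SimpleGraph.deleteEdges_anti h)

lemma reachable_deleteEdges_of_adj {F : Set (Sym2 V)} {u v : V} (h : G.Adj u v)
    (hF : s(u, v) ∉ F) : (G.deleteEdges F).Reachable u v :=
  (SimpleGraph.deleteEdges_adj.2 ⟨h, hF⟩).reachable

lemma reachable_deleteEdges_transfer {F F' : Set (Sym2 V)} {u v : V}
    (h : (G.deleteEdges F).Reachable u v)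
    (hF : ∀ a b, (G.deleteEdges F).Reachable u a → (G.deleteEdges F).Reachable u b →
      G.Adj a b → s(a, b) ∉ F → s(a, b) ∉ F') :
    (G.deleteEdges F').Reachable u v := by
  classical
  obtain ⟨p⟩ := h
  by_contra hcon
  obtain ⟨d, hd, hdU, hdU'⟩ := p.exists_boundary_dart {w | (G.deleteEdges F').Reachable u w}
    SimpleGraph.Reachable.rfl hcon
  have h1 : (G.deleteEdges F).Reachable u d.fst :=
    ⟨p.takeUntil _ (p.dart_fst_mem_support_of_mem_darts hd)⟩
  obtain ⟨hadj, hdF⟩ := SimpleGraph.deleteEdges_adj.1 d.adj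
  exact hdU' (hdU.trans (reachable_deleteEdges_of_adj hadj
    (hF _ _ h1 (h1.trans d.adj.reachable) hadj hdF)))

lemma notMem_of_reachable_deleteEdges_touching {A : Set V} {s k : V} (hs : s ∉ A)
    (h : (G.deleteEdges (touching A)).Reachable s k) : k ∉ A := by
  intro hk
  obtain ⟨p⟩ := h
  obtain ⟨d, -, -, hd⟩ := p.exists_boundary_dart Aᶜ hs (by simpa using hk)
  rw [Set.mem_compl_iff, not_not] at hd
  exact (SimpleGraph.deleteEdges_adj.1 d.adj).2 ⟨_, hd, by simp⟩

lemma not_reachable_deleteEdges_insert {F : Set (Sym2 V)} {x y s t : V}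
    (h : (G.deleteEdges F).Reachable s t)
    (hn : ¬ (G.deleteEdges ({s(x, y)} ∪ F)).Reachable s t) :
    ((G.deleteEdges ({s(x, y)} ∪ F)).Reachable s x ∧
      (G.deleteEdges ({s(x, y)} ∪ F)).Reachable t y) ∨
    ((G.deleteEdges ({s(x, y)} ∪ F)).Reachable s y ∧
      (G.deleteEdges ({s(x, y)} ∪ F)).Reachable t x) := by
  have key : ∀ {s t : V}, (G.deleteEdges F).Reachable s t →
      ¬ (G.deleteEdges ({s(x, y)} ∪ F)).Reachable s t →
      (G.deleteEdges ({s(x, y)} ∪ F)).Reachable s x ∨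
        (G.deleteEdges ({s(x, y)} ∪ F)).Reachable s y := by
    rintro s t ⟨p⟩ hn
    obtain ⟨d, -, hdU, hdU'⟩ := p.exists_boundary_dart
      {w | (G.deleteEdges ({s(x, y)} ∪ F)).Reachable s w} SimpleGraph.Reachable.rfl hn
    obtain ⟨hadj, hF⟩ := SimpleGraph.deleteEdges_adj.1 d.adj
    by_cases he : s(d.fst, d.snd) = s(x, y)
    · rcases Sym2.eq_iff.1 he with ⟨h1, -⟩ | ⟨h1, -⟩
      · exact .inl (h1 ▸ hdU)
      · exact .inr (h1 ▸ hdU)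
    · exact (hdU' (hdU.trans (reachable_deleteEdges_of_adj hadj (by simp [he, hF])))).elim
  rcases key h hn with h1 | h1 <;> rcases key h.symm (fun h => hn h.symm) with h2 | h2
  · exact (hn (h1.trans h2.symm)).elim
  · exact .inl ⟨h1, h2⟩
  · exact .inr ⟨h1, h2⟩
  · exact (hn (h1.trans h2.symm)).elim

/-- If `xy` is needed but is not a bridge, then there are a 2-connected pair `s, t` of terminals
and an item the removal of which, together with `xy`, puts `s` to the side of `y` and `t` to the
side of `x`. -/
lemma EdgeNeeded.exists_item {x y : V} (h : EdgeNeeded G R Q x y)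
    (hxy : (G.deleteEdges {s(x, y)}).Reachable x y) :
    ∃ s ∈ R, ∃ t ∈ R, TwoConn G Q s t ∧ ∃ F,
      ((∃ f, F = {f}) ∨ ∃ q ∈ Q, q ≠ s ∧ q ≠ t ∧ q ≠ x ∧ q ≠ y ∧ F = {e | q ∈ e}) ∧
      (G.deleteEdges ({s(x, y)} ∪ F)).Reachable s y ∧
      (G.deleteEdges ({s(x, y)} ∪ F)).Reachable t x ∧
      ¬ (G.deleteEdges ({s(x, y)} ∪ F)).Reachable x y := by
  obtain ⟨s, hs, t, ht, -, ⟨h1, h2⟩ | ⟨hst, F, hF, hn⟩⟩ := h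
  · exfalso
    have h1' : (G.deleteEdges ∅).Reachable s t := by simpa using h1
    have h2' : ¬ (G.deleteEdges ({s(x, y)} ∪ ∅)).Reachable s t := by simpa using h2
    have := not_reachable_deleteEdges_insert h1' h2'
    simp only [Set.union_empty] at this
    rcases this with ⟨h3, h4⟩ | ⟨h3, h4⟩
    · exact h2 ((h3.trans hxy).trans h4.symm)
    · exact h2 ((h3.trans hxy.symm).trans h4.symm)
  · have hxF : s(x, y) ∉ F := by
      intro h
      rw [Set.union_eq_self_of_subset_left (Set.singleton_subset_iff.2 h)] at hn
      exact hn (hst F hF)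
    have hshape : (∃ f, F = {f}) ∨ ∃ q ∈ Q, q ≠ s ∧ q ≠ t ∧ q ≠ x ∧ q ≠ y ∧
        F = {e | q ∈ e} := by
      rcases hF with hF | ⟨q, hq, hqs, hqt, rfl⟩
      · exact .inl hF
      · refine .inr ⟨q, hq, hqs, hqt, ?_, ?_, rfl⟩
        · rintro rfl
          exact hxF (by simp)
        · rintro rfl
          exact hxF (by simp)
    rcases not_reachable_deleteEdges_insert (hst F hF) hn with ⟨h1, h2⟩ | ⟨h1, h2⟩
    · refine ⟨t, ht, s, hs, hst.symm, F, ?_, h2, h1, fun h => hn ((h1.trans h).trans h2.symm)⟩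
      rcases hshape with h | ⟨q, hq, h1, h2, h3⟩
      · exact .inl h
      · exact .inr ⟨q, hq, h2, h1, h3⟩
    · exact ⟨s, hs, t, ht, hst, F, hshape, h1, h2, fun h => hn ((h1.trans h.symm).trans h2.symm)⟩

/-- The component of `s` in `G \ A` has a neighbor `p`. -/
def IsContact (G : SimpleGraph V) (A : Set V) (s p : V) : Prop :=
  ∃ k, (G.deleteEdges (touching A)).Reachable s k ∧ G.Adj k p

/-- A single contact would be a node of `Q` other than `s` and `t` through which every walk from `s`
to `t` passes. -/
lemma exists_isContact_ne {A : Set V} {s t : V} (hst : TwoConn G Q s t) (hA : A ⊆ Q)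
    (hs : s ∉ A) (ht : t ∉ A) (hsep : ¬ (G.deleteEdges (touching A)).Reachable s t) :
    ∃ p ∈ A, ∃ p' ∈ A, p ≠ p' ∧ IsContact G A s p ∧ IsContact G A s p' := by
  by_contra hcon
  push Not at hcon
  have hleave : ∀ F, IsItem Q s t F → ∃ p ∈ A, IsContact G A s p ∧ ∃ k, s(k, p) ∉ F := by
    intro F hF
    obtain ⟨w⟩ := hst F hF
    obtain ⟨d, -, hdU, hdU'⟩ := w.exists_boundary_dart
      {k | (G.deleteEdges (touching A)).Reachable s k} SimpleGraph.Reachable.rfl hsep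
    obtain ⟨hadj, hdF⟩ := SimpleGraph.deleteEdges_adj.1 d.adj
    refine ⟨d.snd, ?_, ⟨d.fst, hdU, hadj⟩, d.fst, hdF⟩
    by_contra hdA
    refine hdU' (hdU.trans (reachable_deleteEdges_of_adj hadj ?_))
    rintro ⟨a, ha, hae⟩
    rcases Sym2.mem_iff.1 hae with rfl | rfl
    · exact notMem_of_reachable_deleteEdges_touching hs hdU ha
    · exact hdA ha
  -- The loop deletes nothing and yields a first contact `p`; deleting `p` yields the second one.
  obtain ⟨p, hp, hpc, -⟩ := hleave {s(s, s)} (.inl ⟨_, rfl⟩)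
  obtain ⟨p', hp', hpc', k, hk⟩ := hleave {e | p ∈ e}
    (.inr ⟨p, hA hp, fun h => hs (h ▸ hp), fun h => ht (h ▸ hp), rfl⟩)
  refine hcon p hp p' hp' ?_ hpc hpc'
  rintro rfl
  exact hk (by simp)

lemma reachable_segment {z : ℕ → V} {i j : ℕ} {F : Set (Sym2 V)} (hij : i ≤ j)
    (hadj : ∀ k, i ≤ k → k < j → G.Adj (z k) (z (k + 1)))
    (hF : ∀ k, i ≤ k → k < j → s(z k, z (k + 1)) ∉ F) :
    (G.deleteEdges F).Reachable (z i) (z j) := by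
  induction j, hij using Nat.le_induction with
  | base => exact SimpleGraph.Reachable.rfl
  | succ j hij ih =>
    exact (ih (fun k h1 h2 => hadj k h1 (by omega)) (fun k h1 h2 => hF k h1 (by omega))).trans
      (reachable_deleteEdges_of_adj (hadj j hij (by omega)) (hF j hij (by omega)))

/-- The edges of the walk `z i, …, z j`, and all the edges at its inner nodes. -/
def segEdges (z : ℕ → V) (i j : ℕ) : Set (Sym2 V) :=
  {e | ∃ k, i ≤ k ∧ k < j ∧ e = s(z k, z (k + 1))} ∪ {e | ∃ k, i < k ∧ k < j ∧ z k ∈ e}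

lemma segEdges_mono (z : ℕ → V) {i j i' j' : ℕ} (hi : i' ≤ i) (hj : j ≤ j') :
    segEdges z i j ⊆ segEdges z i' j' := by
  rintro e (⟨k, h1, h2, h3⟩ | ⟨k, h1, h2, h3⟩)
  · exact .inl ⟨k, by omega, by omega, h3⟩
  · exact .inr ⟨k, by omega, by omega, h3⟩

/-- `z i, …, z j` is a path or a cycle. -/
def SegInj (z : ℕ → V) (i j : ℕ) : Prop :=
  ∀ k l, i ≤ k → k < l → l ≤ j → z k = z l → k = i ∧ l = j ∧ i + 3 ≤ j

/-- The bound `i + 3 ≤ j` in `SegInj` is what excludes a closed segment of length two, whose two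
edges would coincide. -/
lemma SegInj.edge_ne {z : ℕ → V} {i j : ℕ} (h : SegInj z i j) {k m : ℕ} (hik : i ≤ k)
    (hkm : k < m) (hmj : m < j) : s(z k, z (k + 1)) ≠ s(z m, z (m + 1)) := by
  intro he
  rcases Sym2.eq_iff.1 he with ⟨h1, h2⟩ | ⟨h1, h2⟩
  · have := h k m hik hkm (by omega) h1
    omega
  · have h3 := h k (m + 1) hik (by omega) (by omega) h1
    by_cases hm : k + 1 = m
    · omega
    · have := h (k + 1) m (by omega) (by omega) (by omega) h2
      omega

lemma SegInj.mono {z : ℕ → V} {i j i' j' : ℕ} (h : SegInj z i j) (hi : i < i') (hj : j' ≤ j) :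
    SegInj z i' j' := by
  intro k l h1 h2 h3 h4
  have := h k l (by omega) h2 (by omega) h4
  omega

/-- The edges of `z i, …, z j` that are not on the sub-walk `z p, …, z p'` do not touch the inner
nodes of the sub-walk. -/
lemma SegInj.notMem_segEdges {z : ℕ → V} {i j p p' : ℕ} (h : SegInj z i j)
    (hip : i < p ∨ z i ≠ z j) (hp' : p' ≤ j) {k : ℕ} (hik : i ≤ k) (hkj : k < j)
    (hk : k < p ∨ p' ≤ k) (hi : i ≤ p) :
    s(z k, z (k + 1)) ∉ segEdges z p p' := by
  have h' : ∀ k l, i ≤ k → k < l → l ≤ j → z k = z l → k = i ∧ l = j ∧ i + 3 ≤ j ∧ i < p := by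
    intro k l h1 h2 h3 h4
    obtain ⟨rfl, rfl, h5⟩ := h k l h1 h2 h3 h4
    exact ⟨rfl, rfl, h5, hip.resolve_right (fun h => h h4)⟩
  rintro (⟨m, h1, h2, h3⟩ | ⟨m, h1, h2, h3⟩)
  · rcases lt_trichotomy k m with hkm | hkm | hkm
    · exact h.edge_ne hik hkm (by omega) h3
    · omega
    · exact h.edge_ne (by omega) hkm (by omega) h3.symm
  · have key : ∀ k, i ≤ k → k ≤ j → k ≤ p ∨ p' ≤ k → z m ≠ z k := by
      intro k hik hkj hk he
      rcases lt_trichotomy k m with hkm | hkm | hkm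
      · have := h' k m hik hkm (by omega) he.symm
        omega
      · omega
      · have := h' m k (by omega) hkm hkj he
        omega
    rcases Sym2.mem_iff.1 h3 with h4 | h4
    · exact key k hik (by omega) (by omega) h4
    · exact key (k + 1) (by omega) (by omega) (by omega) h4

end Reach

/-! ### Paths outside the terminals have no parallel connections -/

section Theta

variable {V : Type*} {G : SimpleGraph V} {Q R : Set V}

/-- If every edge is needed, then there is no path (or cycle) with all its inner nodes outside `R`
such that no item separates its ends in the graph without the path. -/
theorem not_twoConn_outside_segment (hE : ∀ x y, G.Adj x y → EdgeNeeded G R Q x y)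
    (hQ : ∀ w, w ∉ R → w ∈ Q) (z : ℕ → V) (i j : ℕ) (hij : i < j)
    (hadj : ∀ k, i ≤ k → k < j → G.Adj (z k) (z (k + 1))) (hinj : SegInj z i j)
    (hR : ∀ k, i < k → k < j → z k ∉ R)
    (hout : ∀ F, IsItem Q (z i) (z j) F →
      (G.deleteEdges (F ∪ segEdges z i j)).Reachable (z i) (z j)) : False := by
  induction hn : j - i using Nat.strong_induction_on generalizing i j with
  | _ n ih =>
  -- Descent on the length: the first edge is needed, and this produces a strictly shorter segment
  -- with the same property. A single edge leaves no room for one, so no separate base case arises.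
  have heseg : s(z i, z (i + 1)) ∈ segEdges z i j := .inl ⟨i, le_rfl, hij, rfl⟩
  have hout' : ∀ F, IsItem Q (z i) (z j) F →
      (G.deleteEdges ({s(z i, z (i + 1))} ∪ F)).Reachable (z i) (z j) := by
    intro F hF
    refine reachable_deleteEdges_mono ?_ (hout F hF)
    rw [Set.union_comm]
    exact Set.union_subset_union_right _ (Set.singleton_subset_iff.2 heseg)
  have hne : ∀ k, i < k → k < j → s(z k, z (k + 1)) ≠ s(z i, z (i + 1)) :=
    fun k h1 h2 => (hinj.edge_ne le_rfl h1 h2).symm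
  obtain ⟨s, hs, t, ht, hst, F, hF, hsy, htx, hxy⟩ :=
    (hE _ _ (hadj i le_rfl hij)).exists_item (x := z i) (y := z (i + 1)) (by
      have h1 := hout' {s(z i, z (i + 1))} (.inl ⟨_, rfl⟩)
      rw [Set.union_self] at h1
      exact h1.trans (reachable_segment (by omega) (fun k h2 h3 => hadj k (by omega) h3)
        (fun k h2 h3 => by simpa using hne k (by omega) h3)).symm)
  set H := G.deleteEdges ({s(z i, z (i + 1))} ∪ F) with hH
  -- The item `F` lies on the rest of the segment, since otherwise the outside connection followed
  -- by the segment backwards would join `z i` to `z (i + 1)`. It is the edge after `z l`, or the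
  -- node `z l`. In the latter case `l = j` is possible, and then `F` is no item for the pair of
  -- ends; hence the guard `l < j`.
  obtain ⟨l, hil, hlj, hAQ, hAF, hBF, hFj⟩ : ∃ l, i + 1 ≤ l ∧ l ≤ j ∧
      (∀ m, i + 1 ≤ m → m ≤ l → z m ∈ Q ∧ z m ≠ s ∧ z m ≠ t) ∧
      (∀ e ∈ F, z l ∈ e) ∧
      (∀ k, l < k → k < j → s(z k, z (k + 1)) ∉ F) ∧
      (l < j → IsItem Q (z i) (z j) F) := by
    have hmid : ∀ m, i + 1 ≤ m → m < j → z m ∈ Q ∧ z m ≠ s ∧ z m ≠ t := by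
      intro m h1 h2
      have h3 := hR m (by omega) h2
      exact ⟨hQ _ h3, fun h => h3 (h ▸ hs), fun h => h3 (h ▸ ht)⟩
    rcases hF with ⟨f, rfl⟩ | ⟨q, hq, hqs, hqt, hqx, hqy, rfl⟩
    · by_cases hl : ∃ l, i + 1 ≤ l ∧ l < j ∧ f = s(z l, z (l + 1))
      · obtain ⟨l, h1, h2, rfl⟩ := hl
        refine ⟨l, h1, h2.le, fun m h3 h4 => hmid m h3 (by omega), by simp, ?_,
          fun _ => .inl ⟨_, rfl⟩⟩
        intro k h3 h4
        rw [Set.mem_singleton_iff]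
        exact (hinj.edge_ne (by omega) h3 h4).symm
      · exfalso
        push Not at hl
        refine hxy ((hout' {f} (.inl ⟨_, rfl⟩)).trans (reachable_segment (by omega)
          (fun k h2 h3 => hadj k (by omega) h3) (fun k h2 h3 => ?_)).symm)
        rintro (h4 | h4)
        · exact hne k (by omega) h3 h4
        · exact hl k h2 h3 h4.symm
    · by_cases hl : ∃ l, i + 1 ≤ l ∧ l ≤ j ∧ z l = q
      · obtain ⟨l, h1, h2, rfl⟩ := hl
        have hl1 : l ≠ i + 1 := fun h => hqy (by rw [h])
        refine ⟨l, h1, h2, ?_, by simp, ?_, ?_⟩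
        · intro m h3 h4
          rcases h4.eq_or_lt with rfl | h4
          · exact ⟨hq, hqs, hqt⟩
          · exact hmid m h3 (by omega)
        · intro k h3 h4 h5
          rcases Sym2.mem_iff.1 h5 with h6 | h6
          · have := hinj l k (by omega) h3 h4.le h6
            omega
          · have := hinj l (k + 1) (by omega) (by omega) (by omega) h6
            omega
        · intro h3
          refine .inr ⟨_, hq, hqx, fun h => ?_, rfl⟩
          have := hinj l j (by omega) h3 le_rfl h
          omega
      · exfalso
        push Not at hl
        refine hxy ((hout' _ (.inr ⟨q, hq, hqx, (hl j (by omega) le_rfl).symm, rfl⟩)).trans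
          (reachable_segment (by omega)
          (fun k h2 h3 => hadj k (by omega) h3) (fun k h2 h3 => ?_)).symm)
        rintro (h4 | h4)
        · exact hne k (by omega) h3 h4
        · rcases Sym2.mem_iff.1 h4 with h6 | h6
          · exact hl k h2 h3.le h6.symm
          · exact hl (k + 1) (by omega) (by omega) h6.symm
  -- Deleting the nodes `z (i + 1), …, z l` deletes both the first edge and `F`, so `A` separates
  -- `s` from `t`. The component `K` of `s` misses the whole segment and has two contacts on `A`,
  -- which bound the shorter segment.
  let A : Set V := {w | ∃ m, i + 1 ≤ m ∧ m ≤ l ∧ w = z m}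
  have hzA : ∀ m, i + 1 ≤ m → m ≤ l → z m ∈ A := fun m h1 h2 => ⟨m, h1, h2, rfl⟩
  have hsA : s ∉ A := fun ⟨m, h1, h2, h3⟩ => (hAQ m h1 h2).2.1 h3.symm
  have htA : t ∉ A := fun ⟨m, h1, h2, h3⟩ => (hAQ m h1 h2).2.2 h3.symm
  have hGA : ∀ {a b}, (G.deleteEdges (touching A)).Reachable a b → H.Reachable a b := by
    intro a b h
    refine reachable_deleteEdges_mono ?_ h
    rintro e (he | he)
    · rw [Set.mem_singleton_iff] at he
      exact ⟨z (i + 1), hzA _ le_rfl hil, by simp [he]⟩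
    · exact ⟨z l, hzA _ hil le_rfl, hAF e he⟩
  let K : Set V := {w | (G.deleteEdges (touching A)).Reachable s w}
  have hKA : ∀ w ∈ K, w ∉ A := fun w hw => notMem_of_reachable_deleteEdges_touching hsA hw
  have hzK : ∀ m, i ≤ m → m ≤ j → z m ∉ K := by
    intro m h1 h2 hm
    rcases h1.eq_or_lt with rfl | h1
    · exact hxy ((hGA hm).symm.trans hsy)
    by_cases h3 : m ≤ l
    · exact hKA _ hm (hzA m h1 h3)
    · have h4 : H.Reachable (z m) (z j) := reachable_segment h2
        (fun k h5 h6 => hadj k (by omega) h6) (fun k h5 h6 => by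
          rintro (h7 | h7)
          · exact hne k (by omega) h6 h7
          · exact hBF k (by omega) h6 h7)
      exact hxy (((hout' F (hFj (by omega))).trans h4.symm).trans ((hGA hm).symm.trans hsy))
  obtain ⟨p, p', hip, hpp', hpl, ⟨k, hk, hkp⟩, ⟨k', hk', hkp'⟩⟩ : ∃ p p', i + 1 ≤ p ∧ p < p' ∧
      p' ≤ l ∧ IsContact G A s (z p) ∧ IsContact G A s (z p') := by
    obtain ⟨_, ⟨p, h1, h2, rfl⟩, _, ⟨p', h1', h2', rfl⟩, hpp', hc, hc'⟩ :=
      exists_isContact_ne (A := A) hst (by rintro _ ⟨m, h1, h2, rfl⟩; exact (hAQ m h1 h2).1)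
        hsA htA (fun h => hxy (htx.symm.trans ((hGA h).symm.trans hsy)))
    rcases lt_trichotomy p p' with h | rfl | h
    · exact ⟨p, p', h1, h, h2', hc, hc'⟩
    · exact (hpp' rfl).elim
    · exact ⟨p', p, h1', h, h2, hc', hc⟩
  refine ih (p' - p) (by omega) p p' hpp' (fun k h1 h2 => hadj k (by omega) (by omega))
    (hinj.mono (by omega) (by omega)) (fun k h1 h2 => hR k (by omega) (by omega)) ?_ rfl
  intro F' hF'
  -- There are two ways around the shorter segment: through `K`, or back along the long segment to
  -- its ends and through its outside connection. An item that blocks the first way touches `K`,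
  -- hence is not on the long segment, and the second way is open.
  by_cases hFK : (∃ f, F' = {f} ∧ ∀ w ∈ f, w ∉ K) ∨ ∃ q, F' = {e | q ∈ e} ∧ q ≠ z p ∧ q ≠ z p' ∧ q ∉ K
  · have hseg : ∀ w ∈ K, ∀ a, (a ∈ K ∨ a = z p ∨ a = z p') → s(a, w) ∉ F' ∪ segEdges z p p' := by
      rintro w hw a ha (h | ⟨m, h1, h2, h3⟩ | ⟨m, h1, h2, h3⟩)
      · rcases hFK with ⟨f, rfl, hf⟩ | ⟨q, rfl, hqp, hqp', hq⟩
        · rw [Set.mem_singleton_iff] at h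
          exact hf w (by simp [← h]) hw
        · rcases Sym2.mem_iff.1 h with rfl | rfl
          · rcases ha with ha | ha | ha
            · exact hq ha
            · exact hqp ha
            · exact hqp' ha
          · exact hq hw
      · have hwm : w ∈ s(z m, z (m + 1)) := by simp [← h3]
        rcases Sym2.mem_iff.1 hwm with rfl | rfl
        · exact hKA _ hw (hzA m (by omega) (by omega))
        · exact hKA _ hw (hzA (m + 1) (by omega) (by omega))
      · rcases Sym2.mem_iff.1 h3 with rfl | rfl
        · rcases ha with ha | ha | ha
          · exact hKA _ ha (hzA m (by omega) (by omega))
          · have := hinj p m (by omega) h1 (by omega) ha.symm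
            omega
          · have := hinj m p' (by omega) h2 (by omega) ha
            omega
        · exact hKA _ hw (hzA m (by omega) (by omega))
    have hKK : ∀ w ∈ K, (G.deleteEdges (F' ∪ segEdges z p p')).Reachable s w := by
      intro w hw
      refine reachable_deleteEdges_transfer hw fun a b ha hb hab _ => hseg b hb a (.inl ha)
    exact ((reachable_deleteEdges_of_adj hkp.symm (hseg k hk _ (.inr (.inl rfl)))).trans
      ((hKK k hk).symm.trans (hKK k' hk'))).trans
      (reachable_deleteEdges_of_adj hkp'.symm (hseg k' hk' _ (.inr (.inr rfl)))).symm
  · have hFz : ∀ k, i ≤ k → k < j → s(z k, z (k + 1)) ∉ F' := by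
      intro k h1 h2 h3
      rcases hF' with ⟨f, rfl⟩ | ⟨q, hq, hqp, hqp', rfl⟩
      · refine hFK (.inl ⟨f, rfl, ?_⟩)
        rw [Set.mem_singleton_iff] at h3
        subst h3
        intro w hw
        rcases Sym2.mem_iff.1 hw with rfl | rfl
        · exact hzK _ h1 h2.le
        · exact hzK _ (by omega) h2
      · refine hFK (.inr ⟨q, rfl, hqp, hqp', ?_⟩)
        rcases Sym2.mem_iff.1 h3 with rfl | rfl
        · exact hzK _ h1 h2.le
        · exact hzK _ (by omega) h2
    have hitem : IsItem Q (z i) (z j) F' := by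
      rcases hF' with hF' | ⟨q, hq, hqp, hqp', rfl⟩
      · exact .inl hF'
      · refine .inr ⟨q, hq, ?_, ?_, rfl⟩
        · rintro rfl
          exact hFK (.inr ⟨_, rfl, hqp, hqp', hzK _ le_rfl hij.le⟩)
        · rintro rfl
          exact hFK (.inr ⟨_, rfl, hqp, hqp', hzK _ hij.le le_rfl⟩)
    have c1 : (G.deleteEdges (F' ∪ segEdges z p p')).Reachable (z i) (z p) :=
      reachable_segment (by omega) (fun k h1 h2 => hadj k h1 (by omega)) (fun k h1 h2 h3 =>
        h3.elim (hFz k h1 (by omega))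
          (hinj.notMem_segEdges (.inl (by omega)) (by omega) h1 (by omega) (.inl h2)
            (by omega)))
    have c2 : (G.deleteEdges (F' ∪ segEdges z p p')).Reachable (z p') (z j) :=
      reachable_segment (by omega) (fun k h1 h2 => hadj k (by omega) (by omega))
        (fun k h1 h2 h3 => h3.elim (hFz k (by omega) (by omega))
          (hinj.notMem_segEdges (.inl (by omega)) (by omega) (by omega) (by omega) (.inr h1)
            (by omega)))
    have c3 : (G.deleteEdges (F' ∪ segEdges z p p')).Reachable (z i) (z j) :=
      reachable_deleteEdges_mono
        (Set.union_subset_union_right _ (segEdges_mono z (by omega) (by omega))) (hout F' hitem)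
    exact (c1.symm.trans c3).trans c2.symm

end Theta

/-! ### 2-connected pairs are not separated by a path outside the terminals -/

section OffPath

variable {V : Type*} {G : SimpleGraph V} {Q R : Set V}

/-- The nodes `z 0, …, z n`. -/
def pathNodes (z : ℕ → V) (n : ℕ) : Set V := {w | ∃ m, m ≤ n ∧ w = z m}

/-- The route runs from `z p` back along the path to `z x`, through the component of `w` to `z y`,
and back along the path to `z p'`. The last two hypotheses say that `F` misses this route. -/
lemma reachable_around {z : ℕ → V} {n : ℕ}
    (hadj : ∀ k, k < n → G.Adj (z k) (z (k + 1))) (hinj : ∀ k l, k < l → l ≤ n → z k ≠ z l)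
    {w : V} (hw : w ∉ pathNodes z n) {x y p p' : ℕ} (hxp : x ≤ p) (hpp' : p < p') (hpy : p' ≤ y)
    (hyn : y ≤ n) (hx : IsContact G (pathNodes z n) w (z x))
    (hy : IsContact G (pathNodes z n) w (z y)) {F : Set (Sym2 V)}
    (hK : ∀ a b, (G.deleteEdges (touching (pathNodes z n))).Reachable w a →
      ((G.deleteEdges (touching (pathNodes z n))).Reachable w b ∨ b = z x ∨ b = z y) →
      s(a, b) ∉ F)
    (hF : ∀ k, (x ≤ k ∧ k < p) ∨ (p' ≤ k ∧ k < y) → s(z k, z (k + 1)) ∉ F) :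
    (G.deleteEdges (F ∪ segEdges z p p')).Reachable (z p) (z p') := by
  have hseg : SegInj z 0 n := fun k l _ h2 h3 h4 => (hinj k l h2 h3 h4).elim
  have hKA : ∀ a, (G.deleteEdges (touching (pathNodes z n))).Reachable w a → a ∉ pathNodes z n :=
    fun a ha => notMem_of_reachable_deleteEdges_touching hw ha
  have hK' : ∀ a b, (G.deleteEdges (touching (pathNodes z n))).Reachable w a →
      ((G.deleteEdges (touching (pathNodes z n))).Reachable w b ∨ b = z x ∨ b = z y) →
      s(a, b) ∉ F ∪ segEdges z p p' := by
    rintro a b ha hb (h | ⟨m, h1, h2, h3⟩ | ⟨m, h1, h2, h3⟩)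
    · exact hK a b ha hb h
    · have ham : a ∈ s(z m, z (m + 1)) := by simp [← h3]
      rcases Sym2.mem_iff.1 ham with rfl | rfl
      · exact hKA _ ha ⟨m, by omega, rfl⟩
      · exact hKA _ ha ⟨m + 1, by omega, rfl⟩
    · rcases Sym2.mem_iff.1 h3 with rfl | rfl
      · exact hKA _ ha ⟨m, by omega, rfl⟩
      · rcases hb with hb | hb | hb
        · exact hKA _ hb ⟨m, by omega, rfl⟩
        · exact hinj x m (by omega) (by omega) hb.symm
        · exact hinj m y (by omega) (by omega) hb
  have hne : 0 < p ∨ z 0 ≠ z n := .inr (hinj 0 n (by omega) le_rfl)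
  obtain ⟨k, hk, hkx⟩ := hx
  obtain ⟨k', hk', hky⟩ := hy
  have hKK : ∀ a, (G.deleteEdges (touching (pathNodes z n))).Reachable w a →
      (G.deleteEdges (F ∪ segEdges z p p')).Reachable w a := fun a ha =>
    reachable_deleteEdges_transfer ha fun c d hc hd _ _ => hK' c d hc (.inl hd)
  have c1 : (G.deleteEdges (F ∪ segEdges z p p')).Reachable (z x) (z p) :=
    reachable_segment hxp (fun k _ h2 => hadj k (by omega)) fun k h1 h2 h3 => h3.elim
      (hF k (.inl ⟨h1, h2⟩))
      (hseg.notMem_segEdges hne (by omega) (by omega) (by omega) (.inl h2) (by omega))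
  have c2 : (G.deleteEdges (F ∪ segEdges z p p')).Reachable (z p') (z y) :=
    reachable_segment hpy (fun k _ h2 => hadj k (by omega)) fun k h1 h2 h3 => h3.elim
      (hF k (.inr ⟨h1, h2⟩))
      (hseg.notMem_segEdges hne (by omega) (by omega) (by omega) (.inr h1) (by omega))
  have c3 := reachable_deleteEdges_of_adj hkx (hK' k _ hk (.inr (.inl rfl)))
  have c4 := reachable_deleteEdges_of_adj hky (hK' k' _ hk' (.inr (.inr rfl)))
  exact (c1.symm.trans (c3.symm.trans (hKK k hk).symm)).trans
    (((hKK k' hk').trans c4).trans c2.symm)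

/-- If the contact intervals of two components overlapped in at least one edge of the path, the
overlap `z p, …, z p'` could be bypassed through either component. No item blocks both bypasses,
which `not_twoConn_outside_segment` forbids. -/
lemma contacts_not_overlapping (hE : ∀ x y, G.Adj x y → EdgeNeeded G R Q x y)
    (hQ : ∀ w, w ∉ R → w ∈ Q) {z : ℕ → V} {n : ℕ}
    (hadj : ∀ k, k < n → G.Adj (z k) (z (k + 1))) (hinj : ∀ k l, k < l → l ≤ n → z k ≠ z l)
    (hR : ∀ k, 0 < k → k ≤ n → z k ∉ R) {w₁ w₂ : V} (hw₁ : w₁ ∉ pathNodes z n)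
    (hw₂ : w₂ ∉ pathNodes z n)
    (hw : ¬ (G.deleteEdges (touching (pathNodes z n))).Reachable w₁ w₂) {x₁ y₁ x₂ y₂ : ℕ}
    (hy₁ : y₁ ≤ n) (hy₂ : y₂ ≤ n)
    (cx₁ : IsContact G (pathNodes z n) w₁ (z x₁)) (cy₁ : IsContact G (pathNodes z n) w₁ (z y₁))
    (cx₂ : IsContact G (pathNodes z n) w₂ (z x₂)) (cy₂ : IsContact G (pathNodes z n) w₂ (z y₂)) :
    min y₁ y₂ ≤ max x₁ x₂ := by
  by_contra hlt
  push Not at hlt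
  obtain ⟨p, hp⟩ : ∃ p, p = max x₁ x₂ := ⟨_, rfl⟩
  obtain ⟨p', hp'⟩ : ∃ p', p' = min y₁ y₂ := ⟨_, rfl⟩
  rw [← hp, ← hp'] at hlt
  have hseg : SegInj z 0 n := fun k l _ h2 h3 h4 => (hinj k l h2 h3 h4).elim
  have hKA : ∀ {w a}, w ∉ pathNodes z n →
      (G.deleteEdges (touching (pathNodes z n))).Reachable w a → ∀ m, m ≤ n → a ≠ z m :=
    fun hw ha m hm h => notMem_of_reachable_deleteEdges_touching hw ha ⟨m, hm, h⟩
  refine not_twoConn_outside_segment hE hQ z p p' hlt (fun k _ h2 => hadj k (by omega))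
    (fun k l h1 h2 h3 h4 => (hinj k l h2 (by omega) h4).elim)
    (fun k h1 h2 => hR k (by omega) (by omega)) fun F hF => ?_
  -- an item that touches one of the two components does not touch the way through the other
  have through : ∀ {w w' : V} {x y : ℕ}, w ∉ pathNodes z n → w' ∉ pathNodes z n →
      ¬ (G.deleteEdges (touching (pathNodes z n))).Reachable w w' → x ≤ p → p' ≤ y → y ≤ n →
      IsContact G (pathNodes z n) w (z x) → IsContact G (pathNodes z n) w (z y) →
      (∃ a, (G.deleteEdges (touching (pathNodes z n))).Reachable w' a ∧
        (F = {e | a ∈ e} ∨ ∃ f, F = {f} ∧ a ∈ f)) →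
      (G.deleteEdges (F ∪ segEdges z p p')).Reachable (z p) (z p') := by
    rintro w w' x y hw hw' hww' hxp hpy hyn cx cy ⟨a, ha, hF⟩
    have hFa : ∀ e ∈ F, a ∈ e := by
      rcases hF with rfl | ⟨f, rfl, hf⟩
      · exact fun e he => he
      · rintro e rfl
        exact hf
    refine reachable_around hadj hinj hw hxp hlt hpy hyn cx cy ?_ ?_
    · intro c d hc hd h
      rcases Sym2.mem_iff.1 (hFa _ h) with rfl | rfl
      · exact hww' (hc.trans ha.symm)
      · rcases hd with hd | hd | hd
        · exact hww' (hd.trans ha.symm)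
        · exact hKA hw' ha x (by omega) hd
        · exact hKA hw' ha y hyn hd
    · intro k hk h
      rcases Sym2.mem_iff.1 (hFa _ h) with h | h
      · exact hKA hw' ha k (by omega) h
      · exact hKA hw' ha (k + 1) (by omega) h
  by_cases h1 : ∃ a, (G.deleteEdges (touching (pathNodes z n))).Reachable w₁ a ∧
        (F = {e | a ∈ e} ∨ ∃ f, F = {f} ∧ a ∈ f)
  · exact through hw₂ hw₁ (fun h => hw h.symm) (by omega) (by omega) hy₂ cx₂ cy₂ h1
  by_cases h2 : ∃ a, (G.deleteEdges (touching (pathNodes z n))).Reachable w₂ a ∧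
        (F = {e | a ∈ e} ∨ ∃ f, F = {f} ∧ a ∈ f)
  · exact through hw₁ hw₂ hw (by omega) (by omega) hy₁ cx₁ cy₁ h2
  push Not at h1 h2
  -- otherwise the item is on the path, and it does not hit both sides of it
  have side : ∀ {w : V} {x y : ℕ}, w ∉ pathNodes z n →
      (∀ a, (G.deleteEdges (touching (pathNodes z n))).Reachable w a →
        F ≠ {e | a ∈ e} ∧ ∀ f, F = {f} → a ∉ f) → x ≤ p → p' ≤ y → y ≤ n →
      IsContact G (pathNodes z n) w (z x) → IsContact G (pathNodes z n) w (z y) →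
      (∀ m, (x ≤ m ∧ m < p) ∨ (p' < m ∧ m ≤ y) → F ≠ {e | z m ∈ e}) →
      (∀ m, (x ≤ m ∧ m < p) ∨ (p' ≤ m ∧ m < y) → F ≠ {s(z m, z (m + 1))}) →
      (G.deleteEdges (F ∪ segEdges z p p')).Reachable (z p) (z p') := by
    intro w x y hw hwF hxp hpy hyn cx cy hm hm'
    have hzF : ∀ q, F = {e | q ∈ e} → ∀ m, (x ≤ m ∧ m ≤ p) ∨ (p' ≤ m ∧ m ≤ y) → q ≠ z m := by
      rintro q hq m hxm rfl
      have hm1 : (m = p ∨ m = p') ∨ (x ≤ m ∧ m < p) ∨ (p' < m ∧ m ≤ y) := by omega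
      rcases hm1 with hm1 | hm1
      · rcases hF with ⟨f, hf⟩ | ⟨q, -, hqp, hqp', hF⟩
        · have e1 : s(z m, z m) ∈ F := by rw [hq]; simp
          have e2 : s(z m, z p) ∈ F := by rw [hq]; simp
          have e3 : s(z m, z p') ∈ F := by rw [hq]; simp
          rw [hf, Set.mem_singleton_iff] at e1 e2 e3
          have h4 := hinj p p' hlt (by omega)
          rw [← e1] at e2 e3
          simp only [Sym2.eq_iff] at e2 e3
          grind
        · have e1 : s(z m, z m) ∈ F := by rw [hq]; simp
          rw [hF] at e1
          have : q = z m := by simpa using e1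
          rcases hm1 with rfl | rfl
          · exact hqp this
          · exact hqp' this
      · exact hm m hm1 hq
    refine reachable_around hadj hinj hw hxp hlt hpy hyn cx cy ?_ ?_
    · intro c d hc hd h
      rcases hF with ⟨f, rfl⟩ | ⟨q, -, hqp, hqp', rfl⟩
      · rw [Set.mem_singleton_iff] at h
        exact (hwF c hc).2 f rfl (by simp [← h])
      · rcases Sym2.mem_iff.1 h with rfl | rfl
        · exact (hwF _ hc).1 rfl
        · rcases hd with hd | hd | hd
          · exact (hwF _ hd).1 rfl
          · exact hzF _ rfl x (by omega) hd
          · exact hzF _ rfl y (by omega) hd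
    · intro k hk h
      rcases hF with ⟨f, rfl⟩ | ⟨q, -, hqp, hqp', rfl⟩
      · rw [Set.mem_singleton_iff] at h
        exact hm' k hk (by rw [h])
      · rcases Sym2.mem_iff.1 h with h | h
        · exact hzF _ rfl k (by omega) h
        · exact hzF _ rfl (k + 1) (by omega) h
  -- If the item lies on the path before `p`, the component whose left contact is `z p` itself is
  -- used: its bypass has no left stretch, and its right stretch is free. Otherwise the left
  -- stretches are free, and the component with right contact `z p'` is used.
  by_cases hL : ∃ m, m < p ∧ (F = {e | z m ∈ e} ∨ F = {s(z m, z (m + 1))})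
  · obtain ⟨m, hmp, hm⟩ := hL
    have hno : ∀ m', p' ≤ m' → m' ≤ n → F ≠ {e | z m' ∈ e} := by
      rintro m' h3 h4 hF'
      have e1 : s(z m', z m') ∈ F := by rw [hF']; simp
      rcases hm with rfl | rfl
      · have : z m = z m' := by simpa using e1
        exact hinj m m' (by omega) h4 this
      · rw [Set.mem_singleton_iff] at e1
        have h5 := hinj m m' (by omega) h4
        simp only [Sym2.eq_iff] at e1
        grind
    have hno' : ∀ m', p' ≤ m' → m' < n → F ≠ {s(z m', z (m' + 1))} := by
      rintro m' h3 h4 hF'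
      rcases hm with rfl | rfl
      · have e1 : s(z m, z m) ∈ ({s(z m', z (m' + 1))} : Set (Sym2 V)) := by rw [← hF']; simp
        have h5 := hinj m m' (by omega) (by omega)
        rw [Set.mem_singleton_iff] at e1
        simp only [Sym2.eq_iff] at e1
        grind
      · exact hseg.edge_ne (by omega) (by omega : m < m') h4 (Set.singleton_injective hF')
    rcases le_total x₁ x₂ with h | h
    · exact side hw₂ h2 (by omega) (by omega) hy₂ cx₂ cy₂ (fun m hm => hno m (by omega) (by omega))
        (fun m hm => hno' m (by omega) (by omega))
    · exact side hw₁ h1 (by omega) (by omega) hy₁ cx₁ cy₁ (fun m hm => hno m (by omega) (by omega))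
        (fun m hm => hno' m (by omega) (by omega))
  · push Not at hL
    rcases le_total y₁ y₂ with h | h
    · exact side hw₁ h1 (by omega) (by omega) hy₁ cx₁ cy₁ (fun m hm => (hL m (by omega)).1)
        (fun m hm => (hL m (by omega)).2)
    · exact side hw₂ h2 (by omega) (by omega) hy₂ cx₂ cy₂ (fun m hm => (hL m (by omega)).1)
        (fun m hm => (hL m (by omega)).2)

lemma pathNodes_chordless (hE : ∀ x y, G.Adj x y → EdgeNeeded G R Q x y)
    (hQ : ∀ w, w ∉ R → w ∈ Q) {z : ℕ → V} {n : ℕ}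
    (hadj : ∀ k, k < n → G.Adj (z k) (z (k + 1))) (hinj : ∀ k l, k < l → l ≤ n → z k ≠ z l)
    (hR : ∀ k, 0 < k → k ≤ n → z k ∉ R) {k l : ℕ} (hkl : k < l) (hl : l ≤ n)
    (h : G.Adj (z k) (z l)) : l = k + 1 := by
  by_contra hne
  -- The chord closes the path to a cycle; index `l + 1` is the return to `z k`. The ends of this
  -- segment coincide, so they are trivially connected outside it.
  refine not_twoConn_outside_segment hE hQ (fun m => if m ≤ l then z m else z k) k (l + 1)
    (by omega) ?_ ?_ ?_ ?_
  · intro m h1 h2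
    rcases (Nat.lt_succ_iff.1 h2).eq_or_lt with rfl | h3
    · simpa using h.symm
    · simpa [h3.le, Nat.succ_le_of_lt h3] using hadj m (by omega)
  · intro a b h1 h2 h3 h4
    by_cases hb : b ≤ l
    · simp only [hb, (by omega : a ≤ l), if_true] at h4
      exact (hinj a b h2 (by omega) h4).elim
    · simp only [hb, (by omega : a ≤ l), if_true, if_false] at h4
      by_contra hcon
      exact hinj k a (by omega) (by omega) h4.symm
  · intro m h1 h2
    simp only [(by omega : m ≤ l), if_true]
    exact hR m (by omega) (by omega)
  · intro F _
    simp [hkl.le]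

/-- In a graph in which all edges are needed, a path of nodes of `Q`, of which only the first one
may be a terminal, does not separate a 2-connected pair of nodes. -/
theorem TwoConn.reachable_off_path (hE : ∀ x y, G.Adj x y → EdgeNeeded G R Q x y)
    (hQ : ∀ w, w ∉ R → w ∈ Q) {z : ℕ → V} {n : ℕ}
    (hadj : ∀ k, k < n → G.Adj (z k) (z (k + 1))) (hinj : ∀ k l, k < l → l ≤ n → z k ≠ z l)
    (hR : ∀ k, 0 < k → k ≤ n → z k ∉ R) (hz : z 0 ∈ Q) {u v : V} (huv : TwoConn G Q u v)
    (hu : u ∉ pathNodes z n) (hv : v ∉ pathNodes z n) :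
    (G.deleteEdges (touching (pathNodes z n))).Reachable u v := by
  classical
  by_contra hsep
  have hAQ : pathNodes z n ⊆ Q := by
    rintro _ ⟨m, hm, rfl⟩
    rcases Nat.eq_zero_or_pos m with rfl | h
    · exact hz
    · exact hQ _ (hR m h hm)
  have extremes : ∀ {u v : V}, TwoConn G Q u v → u ∉ pathNodes z n → v ∉ pathNodes z n →
      ¬ (G.deleteEdges (touching (pathNodes z n))).Reachable u v →
      ∃ a b, a < b ∧ b ≤ n ∧ IsContact G (pathNodes z n) u (z a) ∧
        IsContact G (pathNodes z n) u (z b) ∧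
        ∀ m, m ≤ n → IsContact G (pathNodes z n) u (z m) → a ≤ m ∧ m ≤ b := by
    intro u v huv hu hv hsep
    obtain ⟨_, ⟨p, h1, rfl⟩, _, ⟨p', h1', rfl⟩, hne, hc, hc'⟩ :=
      exists_isContact_ne huv hAQ hu hv hsep
    let I := (Finset.range (n + 1)).filter fun m => IsContact G (pathNodes z n) u (z m)
    have hmem : ∀ m, m ∈ I ↔ m ≤ n ∧ IsContact G (pathNodes z n) u (z m) := by
      simp [I]
    have hp : p ∈ I := (hmem p).2 ⟨h1, hc⟩
    have hp' : p' ∈ I := (hmem p').2 ⟨h1', hc'⟩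
    have hI : I.Nonempty := ⟨p, hp⟩
    have hpp' : p ≠ p' := fun h => hne (by rw [h])
    have i1 := I.min'_le p hp
    have i2 := I.le_max' p hp
    have i3 := I.min'_le p' hp'
    have i4 := I.le_max' p' hp'
    refine ⟨I.min' hI, I.max' hI, by omega, ((hmem _).1 (I.max'_mem hI)).1,
      ((hmem _).1 (I.min'_mem hI)).2, ((hmem _).1 (I.max'_mem hI)).2, fun m h1 h2 => ?_⟩
    have := (hmem m).2 ⟨h1, h2⟩
    exact ⟨I.min'_le m this, I.le_max' m this⟩
  have main : ∀ {u v : V} {a b : ℕ}, TwoConn G Q u v → u ∉ pathNodes z n → v ∉ pathNodes z n →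
      a < b → b ≤ n → IsContact G (pathNodes z n) u (z a) →
      IsContact G (pathNodes z n) u (z b) →
      (∀ m, m ≤ n → IsContact G (pathNodes z n) u (z m) → m ≤ b) →
      (∀ m, m ≤ n → IsContact G (pathNodes z n) v (z m) → b ≤ m) → False := by
    intro u v a b huv hu hv hab hbn ca cb hmax hmin
    have hzb : z b ∈ pathNodes z n := ⟨b, hbn, rfl⟩
    obtain ⟨w⟩ := huv {e | z b ∈ e}
      (.inr ⟨z b, hAQ hzb, fun h => hu (h ▸ hzb), fun h => hv (h ▸ hzb), rfl⟩)
    -- `U` consists of the path before `z b` and of the components with a contact there. Only `z b`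
    -- leads out of it: the path has no chords, the contacts of `u` end at `b`, and a different
    -- component with contacts on both sides of `b` would overlap the contact interval of `u`. So `z
    -- b` alone separates `u` from `v`.
    let U : Set V := {w | (∃ m, m < b ∧ w = z m) ∨
      (w ∉ pathNodes z n ∧ ∃ m, m < b ∧ IsContact G (pathNodes z n) w (z m))}
    have huU : u ∈ U := .inr ⟨hu, a, hab, ca⟩
    have hvU : v ∉ U := by
      rintro (⟨m, h1, rfl⟩ | ⟨-, m, h1, h2⟩)
      · exact hv ⟨m, by omega, rfl⟩
      · have := hmin m (by omega) h2
        omega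
    obtain ⟨d, -, hdU, hdU'⟩ := w.exists_boundary_dart U huU hvU
    obtain ⟨hd, hdF⟩ := SimpleGraph.deleteEdges_adj.1 d.adj
    have hd1 : z b ≠ d.fst := fun h => hdF (by simp [h])
    have hd2 : z b ≠ d.snd := fun h => hdF (by simp [h])
    rcases hdU with ⟨m, hm, h1⟩ | ⟨h1, m, hm, hc⟩
    · by_cases h2 : d.snd ∈ pathNodes z n
      · obtain ⟨m', hm', h3⟩ := h2
        have hmb : m' ≠ b := fun h => hd2 (by rw [h3, h])
        refine hdU' (.inl ⟨m', ?_, h3⟩)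
        by_contra hlt
        rw [h1, h3] at hd
        have := pathNodes_chordless hE hQ hadj hinj hR (by omega : m < m') hm' hd
        omega
      · exact hdU' (.inr ⟨h2, m, hm, d.snd, SimpleGraph.Reachable.rfl, h1 ▸ hd.symm⟩)
    · by_cases h2 : d.snd ∈ pathNodes z n
      · obtain ⟨m', hm', h3⟩ := h2
        have hmb : m' ≠ b := fun h => hd2 (by rw [h3, h])
        refine hdU' (.inl ⟨m', ?_, h3⟩)
        by_contra hlt
        have hc' : IsContact G (pathNodes z n) d.fst (z m') :=
          ⟨d.fst, SimpleGraph.Reachable.rfl, h3 ▸ hd⟩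
        by_cases hr : (G.deleteEdges (touching (pathNodes z n))).Reachable u d.fst
        · have := hmax m' hm' ⟨d.fst, hr, h3 ▸ hd⟩
          omega
        · have := contacts_not_overlapping hE hQ hadj hinj hR hu h1 hr hbn hm' ca cb hc hc'
          omega
      · obtain ⟨k, hk, hkm⟩ := hc
        refine hdU' (.inr ⟨h2, m, hm, k, ?_, hkm⟩)
        refine (reachable_deleteEdges_of_adj hd ?_).symm.trans hk
        rintro ⟨c, hc, hce⟩
        rcases Sym2.mem_iff.1 hce with rfl | rfl
        · exact h1 hc
        · exact h2 hc
  have hsep' : ¬ (G.deleteEdges (touching (pathNodes z n))).Reachable v u := fun h => hsep h.symm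
  obtain ⟨a₁, b₁, hab₁, hb₁, ca₁, cb₁, h₁⟩ := extremes huv hu hv hsep
  obtain ⟨a₂, b₂, hab₂, hb₂, ca₂, cb₂, h₂⟩ := extremes huv.symm hv hu hsep'
  -- The contact intervals of `u` and `v` are nondegenerate and do not overlap, so one of them ends
  -- no later than the other begins.
  have := contacts_not_overlapping hE hQ hadj hinj hR hu hv hsep hb₁ hb₂ ca₁ cb₁ ca₂ cb₂
  by_cases h : b₁ ≤ a₂
  · exact main huv hu hv hab₁ hb₁ ca₁ cb₁ (fun m h3 h4 => (h₁ m h3 h4).2)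
      (fun m h3 h4 => h.trans (h₂ m h3 h4).1)
  · have h' : b₂ ≤ a₁ := by omega
    exact main huv.symm hv hu hab₂ hb₂ ca₂ cb₂ (fun m h3 h4 => (h₂ m h3 h4).2)
      (fun m h3 h4 => h'.trans (h₁ m h3 h4).1)

end OffPath

/-! ### The `R`-components are trees -/

section Component

variable {V : Type*} {G : SimpleGraph V} {Q R : Set V}

lemma Comp.notMem_of_mem_nodes {C : Comp G R} {a : V} (ha : a ∈ C.nodes) : a ∉ R := by
  obtain ⟨⟨a, h⟩, -, rfl⟩ := ha
  exact h

lemma Comp.mem_nodes_of_adj {C : Comp G R} {a b : V} (ha : a ∈ C.nodes) (hab : G.Adj a b)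
    (hb : b ∉ R) : b ∈ C.nodes := by
  obtain ⟨⟨a, h⟩, ha, rfl⟩ := ha
  refine ⟨⟨b, hb⟩, ?_, rfl⟩
  have : (G.induce Rᶜ).Adj ⟨a, h⟩ ⟨b, hb⟩ := hab
  exact C.mem_supp_of_adj_mem_supp ha this

lemma Comp.nonempty_nodes (C : Comp G R) : C.nodes.Nonempty :=
  C.nonempty_supp.image _

lemma Comp.eq_of_mem_nodes {C C' : Comp G R} {a : V} (ha : a ∈ C.nodes) (ha' : a ∈ C'.nodes) :
    C = C' := by
  obtain ⟨a, ha, rfl⟩ := ha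
  obtain ⟨a', ha', h⟩ := ha'
  obtain rfl := Subtype.ext h
  exact SimpleGraph.ConnectedComponent.eq_of_common_vertex ha ha'

lemma Comp.exists_isPath {C : Comp G R} {a b : V} (ha : a ∈ C.nodes) (hb : b ∈ C.nodes) :
    ∃ p : G.Walk a b, p.IsPath ∧ ∀ w ∈ p.support, w ∈ C.nodes := by
  classical
  obtain ⟨a, ha, rfl⟩ := ha
  obtain ⟨b, hb, rfl⟩ := hb
  obtain ⟨p⟩ := C.reachable_of_mem_supp ha hb
  obtain ⟨q, hq, hqs⟩ : ∃ q : G.Walk a.1 b.1, q.IsPath ∧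
      q.support = p.bypass.support.map Subtype.val :=
    ⟨p.bypass.map (SimpleGraph.Embedding.induce _).toHom,
      p.bypass_isPath.map Subtype.val_injective, SimpleGraph.Walk.support_map _ _⟩
  refine ⟨q, hq, ?_⟩
  intro w hw
  rw [hqs, List.mem_map] at hw
  obtain ⟨w, hw, rfl⟩ := hw
  refine ⟨w, ?_, rfl⟩
  rw [SimpleGraph.ConnectedComponent.mem_supp_iff] at ha ⊢
  rw [← ha, SimpleGraph.ConnectedComponent.eq]
  exact ⟨(p.bypass.takeUntil w hw).reverse⟩

lemma rComponent_adj {C : Comp G R} {a b : V} (ha : a ∈ C.nodes) (hab : G.Adj a b) :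
    (rComponent C).Adj a b := ⟨hab, .inl ha⟩

lemma mem_nodes_or_mem_of_adj {C : Comp G R} {a b : V} (h : (rComponent C).Adj a b) :
    a ∈ C.nodes ∨ a ∈ R := by
  by_contra hcon
  push Not at hcon
  exact hcon.1 (Comp.mem_nodes_of_adj (h.2.resolve_left hcon.1) h.1.symm hcon.2)

lemma mem_nodes_or_mem_of_mem_verts {C : Comp G R} {a : V} (h : a ∈ (rComponent C).verts) :
    a ∈ C.nodes ∨ a ∈ R := by
  rcases h with h | ⟨h, b, hb, hba⟩
  · exact .inl h
  · exact mem_nodes_or_mem_of_adj (rComponent_adj hb hba).symm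

lemma exists_walk_rComponent {C : Comp G R} {a b : V} (ha : a ∈ C.nodes)
    (hb : b ∈ (rComponent C).verts) : (rComponent C).spanningCoe.Reachable a b := by
  have key : ∀ {b}, b ∈ C.nodes → (rComponent C).spanningCoe.Reachable a b := by
    intro b hb
    obtain ⟨p, -, hp⟩ := Comp.exists_isPath ha hb
    refine ⟨p.transfer _ ?_⟩
    intro e he
    induction e with
    | _ x y => exact rComponent_adj (hp x (p.fst_mem_support_of_mem_edges he))
                (p.adj_of_mem_edges he)
  rcases hb with hb | ⟨-, c, hc, hcb⟩
  · exact key hb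
  · have : (rComponent C).spanningCoe.Adj c b := rComponent_adj hc hcb
    exact (key hc).trans this.reachable

lemma rComponent_connected (C : Comp G R) : (rComponent C).coe.Connected := by
  obtain ⟨a, ha⟩ := C.nonempty_nodes
  have ha' : a ∈ (rComponent C).verts := .inl ha
  have key : ∀ b, (hb : b ∈ (rComponent C).verts) →
      (rComponent C).coe.Reachable ⟨a, ha'⟩ ⟨b, hb⟩ := by
    intro b hb
    by_contra hcon
    obtain ⟨p⟩ := exists_walk_rComponent ha hb
    obtain ⟨d, -, ⟨h1, h2⟩, h3⟩ := p.exists_boundary_dart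
      {w | ∃ hw : w ∈ (rComponent C).verts, (rComponent C).coe.Reachable ⟨a, ha'⟩ ⟨w, hw⟩}
      ⟨ha', SimpleGraph.Reachable.rfl⟩ (fun h => hcon h.2)
    have hd : (rComponent C).Adj d.fst d.snd := d.adj
    have hd' : (rComponent C).coe.Adj ⟨d.fst, h1⟩ ⟨d.snd, hd.snd_mem⟩ := hd
    exact h3 ⟨hd.snd_mem, h2.trans hd'.reachable⟩
  rw [SimpleGraph.connected_iff]
  exact ⟨fun x y => (key x.1 x.2).symm.trans (key y.1 y.2), ⟨⟨a, ha'⟩⟩⟩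

/-- A cycle is a segment with equal ends, for which the outside connection is trivial; only its base
point may be a terminal. -/
lemma not_isCycle_of_notMem (hE : ∀ x y, G.Adj x y → EdgeNeeded G R Q x y)
    (hQ : ∀ w, w ∉ R → w ∈ Q) {v : V} (c : G.Walk v v)
    (hc : ∀ w ∈ c.support, w ≠ v → w ∉ R) : ¬ c.IsCycle := by
  intro h
  have h3 := h.three_le_length
  have hR : ∀ k, 0 < k → k < c.length → c.getVert k ≠ v := by
    intro k h1 h2 h4
    rcases (h.getVert_endpoint_iff h2.le).1 h4 with h5 | h5 <;> omega
  refine not_twoConn_outside_segment hE hQ c.getVert 0 c.length (by omega)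
    (fun k _ hk => c.adj_getVert_succ hk) ?_ ?_ ?_
  · intro k l _ h1 h2 h4
    rcases Nat.eq_zero_or_pos k with rfl | h5
    · rw [SimpleGraph.Walk.getVert_zero] at h4
      rcases h2.eq_or_lt with h2 | h2
      · exact ⟨rfl, h2, by omega⟩
      · exact (hR l h1 h2 h4.symm).elim
    · have := h.getVert_injOn ⟨h5, by omega⟩ ⟨by omega, h2⟩ h4
      omega
  · intro k h1 h2
    exact hc _ (c.getVert_mem_support k) (hR k h1 h2)
  · intro F _
    simp

/-- Two neighbors in `C` would close a cycle through `C` on which `w` is the only possible terminal.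
In particular, terminals are leaves of the trees. -/
lemma neighbor_unique (hE : ∀ x y, G.Adj x y → EdgeNeeded G R Q x y)
    (hQ : ∀ w, w ∉ R → w ∈ Q) {C : Comp G R} {w a b : V} (hw : w ∉ C.nodes) (ha : a ∈ C.nodes)
    (hb : b ∈ C.nodes) (haw : G.Adj a w) (hbw : G.Adj b w) : a = b := by
  by_contra hab
  obtain ⟨p, hp, hpC⟩ := Comp.exists_isPath ha hb
  have hwp : w ∉ p.support := fun h => hw (hpC w h)
  refine not_isCycle_of_notMem hE hQ (.cons haw.symm (p.concat hbw)) ?_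
    ((SimpleGraph.Walk.cons_isCycle_iff _ _).2 ⟨hp.concat hwp hbw, ?_⟩)
  · intro x hx hxw
    simp only [SimpleGraph.Walk.support_cons, SimpleGraph.Walk.support_concat, List.mem_cons,
      List.mem_append, hxw, false_or, or_false, List.not_mem_nil] at hx
    exact Comp.notMem_of_mem_nodes (hpC x hx)
  · rw [SimpleGraph.Walk.edges_concat]
    simp only [List.concat_eq_append, List.mem_append, List.mem_singleton]
    rintro (h | h)
    · exact hwp (p.fst_mem_support_of_mem_edges h)
    · rcases Sym2.eq_iff.1 h with ⟨h1, -⟩ | ⟨-, h1⟩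
      · exact hbw.ne h1.symm
      · exact hab h1

lemma rComponent_isAcyclic (hE : ∀ x y, G.Adj x y → EdgeNeeded G R Q x y)
    (hQ : ∀ w, w ∉ R → w ∈ Q) (C : Comp G R) : (rComponent C).spanningCoe.IsAcyclic := by
  classical
  intro v c hc
  by_cases h : ∃ w ∈ c.support, w ∈ R
  · obtain ⟨w, hw, hwR⟩ := h
    have hc' := (SimpleGraph.Walk.isCycle_rotate hw).2 hc
    have hnil := hc'.not_nil
    have h1 : (rComponent C).Adj w (c.rotate w hw).snd := SimpleGraph.Walk.adj_snd hnil
    have h2 : (rComponent C).Adj (c.rotate w hw).penultimate w :=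
      SimpleGraph.Walk.adj_penultimate hnil
    have hwC : w ∉ C.nodes := fun h => Comp.notMem_of_mem_nodes h hwR
    exact hc'.snd_ne_penultimate (neighbor_unique hE hQ hwC (h1.2.resolve_left hwC)
      (h2.2.resolve_right hwC) h1.1.symm h2.1)
  · push Not at h
    refine not_isCycle_of_notMem hE hQ (c.mapLe (rComponent C).spanningCoe_le) ?_ (hc.mapLe _)
    intro w hw _
    rw [SimpleGraph.Walk.support_mapLe_eq_support] at hw
    exact h w hw

theorem rComponent_isTree (hE : ∀ x y, G.Adj x y → EdgeNeeded G R Q x y)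
    (hQ : ∀ w, w ∉ R → w ∈ Q) (C : Comp G R) : (rComponent C).coe.IsTree where
  connected := rComponent_connected C
  isAcyclic := (rComponent_isAcyclic hE hQ C).embedding
    (rComponent C).coeEmbeddingSpanningCoe

/-- An isolated non-terminal can be deleted as a node, and the only edge at a non-terminal of degree
one is of no use between terminals. The bound makes the DFS traversals long enough to be simple
cycles. -/
lemma exists_two_neighbors {r : Sym2 V → ℕ} (hG : IsMinimallyRQConnected G R r Q)
    (hE : ∀ x y, G.Adj x y → EdgeNeeded G R Q x y) {c : V} (hc : c ∉ R) :
    ∃ a b, a ≠ b ∧ G.Adj c a ∧ G.Adj c b := by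
  have h1 : ∃ a, G.Adj c a := by
    by_contra hcon
    push Not at hcon
    let H : G.Subgraph := (⊤ : G.Subgraph).deleteVerts {c}
    have hH : H.spanningCoe = G := by
      ext a b
      simp only [H, SimpleGraph.Subgraph.spanningCoe_adj, SimpleGraph.Subgraph.deleteVerts_adj,
        SimpleGraph.Subgraph.verts_top, Set.mem_univ, Set.mem_singleton_iff, true_and,
        SimpleGraph.Subgraph.top_adj]
      refine ⟨fun h => h.2.2, fun h => ⟨?_, ?_, h⟩⟩
      · rintro rfl
        exact hcon _ h
      · rintro rfl
        exact hcon _ h.symm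
    have htop := hG.2 H (by
      intro w hw
      refine ⟨trivial, ?_⟩
      rintro rfl
      exact hc hw) (hH.symm ▸ hG.1)
    have : c ∈ H.verts := by rw [htop]; trivial
    exact this.2 rfl
  obtain ⟨a, ha⟩ := h1
  by_contra hcon
  push Not at hcon
  have huniq : ∀ b, G.Adj c b → b = a := fun b hb => by
    by_contra hba
    exact hcon a b (fun h => hba h.symm) ha hb
  have hisol : ∀ {F : Set (Sym2 V)} {s : V}, s ∈ R →
      ¬ (G.deleteEdges ({s(c, a)} ∪ F)).Reachable s c := by
    rintro F s hs ⟨p⟩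
    obtain ⟨d, -, -, hd⟩ := p.exists_boundary_dart {c}ᶜ (by rintro rfl; exact hc hs) (by simp)
    have hd : d.snd = c := by simpa using hd
    obtain ⟨h1, h2⟩ := SimpleGraph.deleteEdges_adj.1 d.adj
    rw [hd] at h1 h2
    exact h2 (.inl (by rw [huniq _ h1.symm]; exact Sym2.eq_swap))
  have key : ∀ {F : Set (Sym2 V)} {s t : V}, s ∈ R → t ∈ R → (G.deleteEdges F).Reachable s t →
      (G.deleteEdges ({s(c, a)} ∪ F)).Reachable s t := by
    intro F s t hs ht hst
    by_contra hn
    rcases not_reachable_deleteEdges_insert hst hn with ⟨h, -⟩ | ⟨-, h⟩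
    · exact hisol hs h
    · exact hisol ht h
  obtain ⟨s, hs, t, ht, -, ⟨h1, h2⟩ | ⟨hst, F, hF, hn⟩⟩ := hE c a ha
  · have := key (F := ∅) hs ht (by simpa using h1)
    exact h2 (by simpa using this)
  · exact hn (key hs ht (hst F hF))

end Component

/-! ### Closed walks that use every edge once in each direction -/

section Traversal

variable {V : Type*}

/-- Take a longest closed walk without repeated darts whose darts are closed under reversal. If it
missed a reachable dart, it would miss one that leaves a visited node, and this dart could be
inserted followed by its reverse. Acyclicity plays no role. -/
lemma exists_closed_walk_all_darts [Finite V] (H : SimpleGraph V) (a : V) :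
    ∃ W : H.Walk a a, W.darts.Nodup ∧ ∀ d : H.Dart, H.Reachable a d.fst → d ∈ W.darts := by
  classical
  have := Fintype.ofFinite V
  let P : ℕ → Prop := fun n => ∃ W : H.Walk a a, W.darts.Nodup ∧
    (∀ d ∈ W.darts, d.symm ∈ W.darts) ∧ W.length = n
  have hbound : ∀ n, P n → n ≤ Fintype.card H.Dart := by
    rintro n ⟨W, h, -, rfl⟩
    rw [← W.length_darts]
    exact h.length_le_card
  have hP0 : P 0 := ⟨.nil, by simp, by simp, rfl⟩
  obtain ⟨W, hnd, hsymm, hlen⟩ := Nat.findGreatest_spec (P := P)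
    (Nat.zero_le (Fintype.card H.Dart)) hP0
  refine ⟨W, hnd, fun d hd => ?_⟩
  by_contra hdW
  obtain ⟨d, hdW, hx⟩ : ∃ d : H.Dart, d ∉ W.darts ∧ d.fst ∈ W.support := by
    by_cases hs : d.fst ∈ W.support
    · exact ⟨d, hdW, hs⟩
    · obtain ⟨q⟩ := hd
      obtain ⟨e, -, h1, h2⟩ := q.exists_boundary_dart {w | w ∈ W.support} W.start_mem_support hs
      exact ⟨e, fun h => h2 (W.dart_snd_mem_support_of_mem_darts h), h1⟩
  have hdW' : d.symm ∉ W.darts := fun h => hdW (by simpa using hsymm _ h)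
  let W' := (W.takeUntil _ hx).append (.cons d.adj (.cons d.adj.symm (W.dropUntil _ hx)))
  have hdarts : (W.takeUntil _ hx).darts ++ (W.dropUntil _ hx).darts = W.darts := by
    rw [← SimpleGraph.Walk.darts_append, SimpleGraph.Walk.take_spec]
  have hW' : W'.darts = (W.takeUntil _ hx).darts ++ d :: d.symm :: (W.dropUntil _ hx).darts := by
    simp only [W', SimpleGraph.Walk.darts_append, SimpleGraph.Walk.darts_cons]
    rfl
  have hperm : W'.darts.Perm (d :: d.symm :: W.darts) := by
    rw [hW', ← hdarts]
    refine List.perm_middle.trans (List.Perm.cons _ ?_)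
    exact List.perm_middle
  have hP : P (W.length + 2) := by
    refine ⟨W', ?_, ?_, ?_⟩
    · rw [hperm.nodup_iff]
      simp [hdW, hdW', hnd, (SimpleGraph.Dart.symm_ne d).symm]
    · intro e he
      rw [hperm.mem_iff] at he ⊢
      simp only [List.mem_cons] at he ⊢
      rcases he with rfl | rfl | he
      · simp
      · simp
      · exact .inr (.inr (hsymm e he))
    · rw [← W'.length_darts, hperm.length_eq]
      simp
  have h1 := Nat.le_findGreatest (hbound _ hP) hP
  omega

lemma map_toProd_darts_transfer {G H : SimpleGraph V} {u v : V} (p : G.Walk u v)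
    (hp : ∀ e ∈ p.edges, e ∈ H.edgeSet) :
    (p.transfer H hp).darts.map SimpleGraph.Dart.toProd = p.darts.map SimpleGraph.Dart.toProd := by
  induction p with
  | nil => rfl
  | cons h p ih =>
    exact congrArg (List.cons _) (ih _)

/-- Each visit to a node is labelled by the dart along which the walk leaves it, so an injective `f`
gives distinct copies to distinct visits. No dart leaves the last node, so its copy `y` is free. -/
lemma exists_lifted_walk {ι : V → Type*} {H : SimpleGraph V} (f : H.Dart → Σ v, ι v)
    (hf : ∀ d, (f d).1 = d.fst) {a b : V} (W : H.Walk a b) (y : Σ v, ι v) (hy : y.1 = b) :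
    ∃ (x : Σ v, ι v) (p : (⊤ : SimpleGraph (Σ v, ι v)).Walk x y), x.1 = a ∧
      p.support = W.darts.map f ++ [y] ∧
      p.darts.map (fun d => (d.fst.1, d.snd.1)) = W.darts.map SimpleGraph.Dart.toProd := by
  induction W with
  | nil => exact ⟨y, .nil, hy, by simp, by simp⟩
  | @cons u v w h W ih =>
    obtain ⟨x, p, hx, hs, hd⟩ := ih hy
    have hadj : (⊤ : SimpleGraph (Σ v, ι v)).Adj (f ⟨(u, v), h⟩) x := by
      intro heq
      have := hf ⟨(u, v), h⟩
      rw [heq, hx] at this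
      exact h.ne this.symm
    refine ⟨_, .cons hadj p, hf _, by simp [hs], ?_⟩
    simp only [SimpleGraph.Walk.darts_cons, List.map_cons, hd, hf, hx]

end Traversal

/-! ### Existence of DFS cycles -/

section DFS

variable {V : Type*} {G : SimpleGraph V} {Q R : Set V}

lemma mem_replacedNodes {S : Set (Comp G R)} {C : Comp G R} (hC : C ∈ S) {v : V}
    (hv : v ∈ C.nodes) : v ∈ replacedNodes S :=
  Set.mem_biUnion hC hv

lemma notMem_replacedNodes {S : Set (Comp G R)} {v : V} (hv : v ∈ R) : v ∉ replacedNodes S := by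
  intro h
  obtain ⟨C, -, hC⟩ := Set.mem_iUnion₂.1 h
  exact Comp.notMem_of_mem_nodes hC hv

/-- Both cases of `numCopies` are the degree in the tree, a terminal being a leaf. This allows the
copies of a node to be indexed by its neighbors. -/
lemma numCopies_eq_ncard (hE : ∀ x y, G.Adj x y → EdgeNeeded G R Q x y)
    (hQ : ∀ w, w ∉ R → w ∈ Q) {S : Set (Comp G R)} {C : Comp G R} (hC : C ∈ S) {v : V}
    (hv : v ∈ (rComponent C).verts) :
    ((rComponent C).spanningCoe.neighborSet v).ncard = numCopies S v := by
  unfold numCopies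
  by_cases hvC : v ∈ C.nodes
  · rw [if_pos (mem_replacedNodes hC hvC)]
    congr 1
    ext w
    exact ⟨fun h => h.1, fun h => ⟨h, .inl hvC⟩⟩
  · have hvR := (mem_nodes_or_mem_of_mem_verts hv).resolve_left hvC
    rw [if_neg (notMem_replacedNodes hvR)]
    obtain ⟨-, c, hc, hcv⟩ := hv.resolve_left hvC
    rw [Set.ncard_eq_one]
    refine ⟨c, Set.eq_singleton_iff_unique_mem.2 ⟨⟨hcv.symm, .inr hc⟩, ?_⟩⟩
    intro w hw
    exact neighbor_unique hE hQ hvC (hw.2.resolve_left hvC) hc hw.1.symm hcv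

theorem exists_isDFSCycle [Finite V] (hE : ∀ x y, G.Adj x y → EdgeNeeded G R Q x y)
    (hQ : ∀ w, w ∉ R → w ∈ Q) (hdeg : ∀ c, c ∉ R → ∃ a b, a ≠ b ∧ G.Adj c a ∧ G.Adj c b)
    {S : Set (Comp G R)} {C : Comp G R} (hC : C ∈ S) :
    ∃ D : SimpleGraph (NewNode S), IsDFSCycle S (rComponent C) D := by
  classical
  obtain ⟨a, ha⟩ := C.nonempty_nodes
  obtain ⟨b, b', hbb', hab, hab'⟩ := hdeg a (Comp.notMem_of_mem_nodes ha)
  set H := (rComponent C).spanningCoe with hH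
  have hcard : ∀ v, v ∈ (rComponent C).verts →
      Nonempty (H.neighborSet v ≃ Fin (numCopies S v)) := by
    intro v hv
    refine ⟨Finite.equivFinOfCardEq ?_⟩
    rw [Nat.card_coe_set_eq]
    exact numCopies_eq_ncard hE hQ hC hv
  let φ := fun v hv => (hcard v hv).some
  let f : H.Dart → NewNode S := fun d =>
    ⟨d.fst, φ d.fst ((rComponent C).edge_vert d.adj) ⟨d.snd, d.adj⟩⟩
  have hf : ∀ d, (f d).1 = d.fst := fun _ => rfl
  have hfinj : Function.Injective f := by
    rintro ⟨⟨u, v⟩, h⟩ ⟨⟨u', v'⟩, h'⟩ heq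
    obtain ⟨h1, h2⟩ := Sigma.mk.inj_iff.1 heq
    obtain rfl : u = u' := h1
    have h3 := (φ u ((rComponent C).edge_vert h)).injective (eq_of_heq h2)
    obtain rfl : v = v' := congrArg Subtype.val h3
    rfl
  obtain ⟨W, hnd, hall⟩ := exists_closed_walk_all_darts H a
  have hall' : ∀ d : H.Dart, d ∈ W.darts := fun d =>
    hall d (exists_walk_rComponent ha ((rComponent C).edge_vert d.adj))
  -- Two neighbors of the non-terminal `a` give three distinct darts; three is the least length of a
  -- cycle.
  have hlen : 3 ≤ W.length := by
    have d1 : H.Adj a b := rComponent_adj ha hab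
    have d2 : H.Adj a b' := rComponent_adj ha hab'
    rw [← W.length_darts, ← List.toFinset_card_of_nodup hnd]
    have hsub : ({⟨(a, b), d1⟩, ⟨(a, b'), d2⟩, ⟨(b, a), d1.symm⟩} : Finset H.Dart) ⊆
        W.darts.toFinset := fun d _ => List.mem_toFinset.2 (hall' d)
    refine le_trans ?_ (Finset.card_le_card hsub)
    rw [Finset.card_eq_three.2 ⟨_, _, _, ?_, ?_, ?_, rfl⟩]
    · simpa [SimpleGraph.Dart.ext_iff] using hbb'
    · simp [SimpleGraph.Dart.ext_iff, hab.ne]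
    · simp [SimpleGraph.Dart.ext_iff, hab.ne]
  -- The first dart is split off: the remaining walk lifts to a path ending at the copy of this
  -- dart, and the first dart closes it to a cycle.
  cases W with
  | nil => simp at hlen
  | @cons _ c _ h W =>
    obtain ⟨x, p, hx, hs, hd⟩ := exists_lifted_walk f hf W (f ⟨(a, c), h⟩) rfl
    have hadj : (⊤ : SimpleGraph (NewNode S)).Adj (f ⟨(a, c), h⟩) x := by
      intro heq
      have h1 : (f ⟨(a, c), h⟩).1 = a := rfl
      rw [heq, hx] at h1
      exact h.ne h1.symm
    rw [SimpleGraph.Walk.darts_cons, List.nodup_cons] at hnd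
    have hpath : p.IsPath := by
      rw [SimpleGraph.Walk.isPath_def, hs, List.nodup_append]
      refine ⟨hnd.2.map hfinj, by simp, ?_⟩
      rintro _ h1 _ h2 rfl
      obtain ⟨d, hdW, hd2⟩ := List.mem_map.1 h1
      rw [List.mem_singleton] at h2
      exact hnd.1 (hfinj (hd2.trans h2) ▸ hdW)
    have hplen : 2 ≤ p.length := by
      have h1 := congrArg List.length hs
      simp only [SimpleGraph.Walk.length_support, List.length_append, List.length_map,
        SimpleGraph.Walk.length_darts, List.length_singleton] at h1
      rw [SimpleGraph.Walk.length_cons] at hlen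
      omega
    let q : (⊤ : SimpleGraph (NewNode S)).Walk _ _ := .cons hadj p
    have hq : q.IsCycle := by
      refine (SimpleGraph.Walk.cons_isCycle_iff _ _).2 ⟨hpath, fun he => ?_⟩
      rw [Sym2.eq_swap] at he
      have := hpath.length_eq_one_of_mem_edges he
      omega
    have hqd : q.darts.map (fun d => (d.fst.1, d.snd.1)) =
        (SimpleGraph.Walk.cons h W).darts.map SimpleGraph.Dart.toProd := by
      simp only [q, SimpleGraph.Walk.darts_cons, List.map_cons, hd, hf, hx]
    let D : SimpleGraph (NewNode S) := SimpleGraph.fromEdgeSet {e | e ∈ q.edges}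
    have hqD : ∀ e ∈ q.edges, e ∈ D.edgeSet := by
      intro e he
      simp only [D, SimpleGraph.edgeSet_fromEdgeSet]
      exact ⟨he, (⊤ : SimpleGraph _).not_isDiag_of_mem_edgeSet (q.edges_subset_edgeSet he)⟩
    let q' := q.transfer D hqD
    have hqd' : q'.darts.map (fun d => (d.fst.1, d.snd.1)) =
        (SimpleGraph.Walk.cons h W).darts.map SimpleGraph.Dart.toProd := by
      rw [← hqd]
      have h1 := congrArg (List.map fun x : NewNode S × NewNode S => (x.1.1, x.2.1))
        (map_toProd_darts_transfer q hqD)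
      simpa [List.map_map, Function.comp_def] using h1
    refine ⟨D, _, q', hq.transfer _, ?_, ?_, ?_, ?_⟩
    · intro e he
      rw [SimpleGraph.Walk.edges_transfer]
      simp only [D, SimpleGraph.edgeSet_fromEdgeSet] at he
      exact he.1
    · intro y
      have hsupp : y ∈ q'.support ↔ ∃ d, f d = y := by
        rw [SimpleGraph.Walk.support_transfer]
        simp only [q, SimpleGraph.Walk.support_cons, hs, List.mem_cons, List.mem_append,
          List.mem_map, List.not_mem_nil, or_false]
        constructor
        · rintro (rfl | ⟨d, -, rfl⟩ | rfl)
          exacts [⟨_, rfl⟩, ⟨_, rfl⟩, ⟨_, rfl⟩]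
        · rintro ⟨d, rfl⟩
          rcases List.mem_cons.1 (hall' d) with rfl | hdW
          · exact .inl rfl
          · exact .inr (.inl ⟨d, hdW, rfl⟩)
      rw [hsupp]
      constructor
      · rintro ⟨d, rfl⟩
        exact (rComponent C).edge_vert d.adj
      · intro hy
        obtain ⟨v, i⟩ := y
        obtain ⟨⟨w, hw⟩, hi⟩ := (φ v hy).surjective i
        exact ⟨⟨(v, w), hw⟩, Sigma.ext rfl (heq_of_eq hi)⟩
    · intro d hdq
      have h1 : (d.fst.1, d.snd.1) ∈ q'.darts.map (fun d => (d.fst.1, d.snd.1)) :=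
        List.mem_map.2 ⟨d, hdq, rfl⟩
      rw [hqd'] at h1
      obtain ⟨e, -, he⟩ := List.mem_map.1 h1
      have := e.adj
      rw [he] at this
      exact this
    · intro u v huv
      have h1 : (u, v) ∈ (SimpleGraph.Walk.cons h W).darts.map SimpleGraph.Dart.toProd :=
        List.mem_map.2 ⟨⟨(u, v), huv⟩, hall' _, rfl⟩
      rw [← hqd'] at h1
      obtain ⟨d, hdq, hd'⟩ := List.mem_map.1 h1
      obtain ⟨hd1, hd2⟩ := Prod.mk.inj hd'
      refine ⟨d, ⟨hdq, hd1, hd2⟩, ?_⟩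
      rintro e ⟨heq, he1, he2⟩
      have hnd' : (q'.darts.map (fun d => (d.fst.1, d.snd.1))).Nodup := by
        rw [hqd']
        refine List.Nodup.map ?_ ?_
        · intro d d' h
          exact SimpleGraph.Dart.ext _ _ h
        · rw [SimpleGraph.Walk.darts_cons, List.nodup_cons]
          exact hnd
      exact List.inj_on_of_nodup_map hnd' heq hdq (by simp only [he1, he2, hd1, hd2])

end DFS

/-! ### Cuts of a DFS cycle -/

section CycleCuts

variable {V : Type*} {G : SimpleGraph V} {Q R : Set V} {S : Set (Comp G R)} {C : Comp G R}
  {D : SimpleGraph (NewNode S)}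

lemma IsDFSCycle.adj (hD : IsDFSCycle S (rComponent C) D) {x y : NewNode S} (h : D.Adj x y) :
    (rComponent C).Adj x.1 y.1 := by
  obtain ⟨_, p, -, hp, -, hT, -⟩ := hD
  have he := hp s(x, y) h
  rw [SimpleGraph.Walk.edges, List.mem_map] at he
  obtain ⟨d, hd, hde⟩ := he
  rcases SimpleGraph.dart_edge_eq_mk'_iff'.1 hde with ⟨h1, h2⟩ | ⟨h1, h2⟩
  · exact h1 ▸ h2 ▸ hT d hd
  · exact h1 ▸ h2 ▸ (hT d hd).symm

/-- The edge `e` has one end in `σ` and the other one outside of it. -/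
def Crosses {N : Type*} (σ : N → Prop) (e : Sym2 N) : Prop := ∃ x y, e = s(x, y) ∧ σ x ∧ ¬ σ y

lemma crosses_mk {N : Type*} {σ : N → Prop} {x y : N} :
    Crosses σ s(x, y) ↔ ¬ (σ x ↔ σ y) := by
  constructor
  · rintro ⟨a, b, h, ha, hb⟩
    rcases Sym2.eq_iff.1 h with ⟨rfl, rfl⟩ | ⟨rfl, rfl⟩ <;> tauto
  · intro h
    by_cases hx : σ x
    · exact ⟨x, y, rfl, hx, by tauto⟩
    · exact ⟨y, x, Sym2.eq_swap, by tauto, hx⟩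

open Classical in
lemma even_countP_crosses {N : Type*} {D : SimpleGraph N} (σ : N → Prop) {a b : N}
    (p : D.Walk a b) : Even (p.edges.countP fun e => Crosses σ e) ↔ (σ a ↔ σ b) := by
  induction p with
  | nil => simp
  | @cons a b c h p ih =>
    rw [SimpleGraph.Walk.edges_cons, List.countP_cons]
    by_cases hc : Crosses σ s(a, b)
    · simp only [hc, decide_true, if_true, Nat.even_add_one, ih]
      rw [crosses_mk] at hc
      tauto
    · simp only [hc, decide_false, Bool.false_eq_true, if_false, add_zero, ih]
      rw [crosses_mk] at hc
      tauto

lemma IsDFSCycle.even_card (hD : IsDFSCycle S (rComponent C) D) (σ : NewNode S → Prop)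
    (N : Finset (Sym2 (NewNode S))) (hN : ∀ e, e ∈ N ↔ e ∈ D.edgeSet ∧ Crosses σ e) :
    Even N.card := by
  classical
  obtain ⟨_, p, hc, hp, -⟩ := hD
  have h1 : N = (p.edges.filter fun e => Crosses σ e).toFinset := by
    ext e
    rw [hN, List.mem_toFinset, List.mem_filter, decide_eq_true_iff]
    exact ⟨fun h => ⟨hp e h.1, h.2⟩, fun h => ⟨p.edges_subset_edgeSet h.1, h.2⟩⟩
  rw [h1, List.toFinset_card_of_nodup (hc.isCircuit.isTrail.edges_nodup.filter _),
    ← List.countP_eq_length_filter]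
  exact (even_countP_crosses σ p).2 Iff.rfl

/-- Read backwards from `b`: a walk that ends in `K` and never enters `K` stays in `K`, hence off
`M`, where no edge crosses `σ`. -/
lemma same_side_of_walk {T : G.Subgraph} {σ : NewNode S → Prop} {M K : Set V}
    (hKM : ∀ w ∈ K, w ∉ M)
    (hσ : ∀ x y, D.Adj x y → x.1 ∉ M → y.1 ∉ M → (σ x ↔ σ y)) {a b : NewNode S}
    (p : D.Walk a b) (hT : ∀ d ∈ p.darts, T.Adj d.fst.1 d.snd.1)
    (hp : ∀ d ∈ p.darts, d.snd.1 ∈ K → d.fst.1 ∈ K) (hb : b.1 ∈ K) :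
    a.1 ∈ K ∧ (σ a ↔ σ b) := by
  induction p with
  | nil => exact ⟨hb, Iff.rfl⟩
  | @cons a c b h p ih =>
    obtain ⟨h1, h2⟩ := ih (fun d hd => hT d (by simp [hd])) (fun d hd => hp d (by simp [hd])) hb
    have h3 : a.1 ∈ K := hp ⟨(a, c), h⟩ (by simp) h1
    exact ⟨h3, (hσ a c h (hKM _ h3) (hKM _ h1)).trans h2⟩

/-- If the edges of a DFS cycle that avoid the connected part `M` of the tree do not cross `σ`,
then all copies of adjacent nodes of the tree outside `M` are on the same side of `σ`. -/
lemma IsDFSCycle.same_side (hD : IsDFSCycle S (rComponent C) D)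
    (hac : (rComponent C).spanningCoe.IsAcyclic) {σ : NewNode S → Prop} {M : Set V}
    (hM : ∀ m m', m ∈ M → m' ∈ M → m ∈ (rComponent C).verts → m' ∈ (rComponent C).verts →
      ∃ p : (rComponent C).spanningCoe.Walk m m', ∀ w ∈ p.support, w ∈ M)
    (hσ : ∀ x y, D.Adj x y → x.1 ∉ M → y.1 ∉ M → (σ x ↔ σ y)) {x y : NewNode S}
    (hxy : (rComponent C).Adj x.1 y.1) (hx : x.1 ∉ M) (hy : y.1 ∉ M) : σ x ↔ σ y := by
  classical
  set H := (rComponent C).spanningCoe with hH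
  let K : Set V := {w | (H.deleteEdges (touching M)).Reachable x.1 w}
  have hKM : ∀ w ∈ K, w ∉ M := fun w hw => notMem_of_reachable_deleteEdges_touching hx hw
  have hstep : ∀ a b, (rComponent C).Adj a b → a ∈ K → b ∉ M → b ∈ K := by
    intro a b hab ha hb
    have hab' : H.Adj a b := hab
    refine SimpleGraph.Reachable.trans ha (reachable_deleteEdges_of_adj hab' ?_)
    rintro ⟨c, hc, hce⟩
    rcases Sym2.mem_iff.1 hce with rfl | rfl
    · exact hKM _ ha hc
    · exact hb hc
  have hxK : x.1 ∈ K := SimpleGraph.Reachable.rfl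
  have hyK : y.1 ∈ K := hstep _ _ hxy hxK hy
  -- the component `K` of the tree without `M` is entered by one edge only
  have hentry : ∀ {m k m' k'}, (rComponent C).Adj m k → m ∉ K → k ∈ K →
      (rComponent C).Adj m' k' → m' ∉ K → k' ∈ K → m = m' ∧ k = k' := by
    intro m k m' k' hmk hm hk hmk' hm' hk'
    have hmM : m ∈ M := by
      by_contra h
      exact hm (hstep k m hmk.symm hk h)
    have hmM' : m' ∈ M := by
      by_contra h
      exact hm' (hstep k' m' hmk'.symm hk' h)
    by_contra hne
    -- A second entering edge would, with walks inside `M` and inside `K`, bypass the first one,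
    -- which is a bridge of the forest.
    have hbr := SimpleGraph.isAcyclic_iff_forall_adj_isBridge.1 hac
      (show H.Adj m k from hmk)
    rw [SimpleGraph.isBridge_iff] at hbr
    have c1 : (H.deleteEdges {s(m, k)}).Reachable k k' := by
      refine reachable_deleteEdges_mono (F := touching M) ?_ (SimpleGraph.Reachable.trans
        (SimpleGraph.Reachable.symm hk) hk')
      rintro e rfl
      exact ⟨m, hmM, by simp⟩
    have c2 : (H.deleteEdges {s(m, k)}).Reachable m' k' := by
      refine reachable_deleteEdges_of_adj (show H.Adj m' k' from hmk') ?_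
      rw [Set.mem_singleton_iff]
      intro h
      rcases Sym2.eq_iff.1 h with ⟨h1, h2⟩ | ⟨h1, h2⟩
      · exact hne ⟨h1.symm, h2.symm⟩
      · exact hKM _ hk' (h2 ▸ hmM)
    obtain ⟨p, hp⟩ := hM m m' hmM hmM' hmk.fst_mem hmk'.fst_mem
    have c3 : (H.deleteEdges {s(m, k)}).Reachable m m' := by
      refine reachable_deleteEdges_of_walk p fun e he h => ?_
      rw [Set.mem_singleton_iff] at h
      subst h
      exact hKM k hk (hp k (p.snd_mem_support_of_mem_edges he))
    exact hbr ((c3.trans c2).trans c1.symm)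
  obtain ⟨x₀, p, hc, -, hsupp, hT, huniq⟩ := hD
  have hxp : x ∈ p.support := (hsupp x).2 hxy.fst_mem
  have hyp : y ∈ (p.rotate x hxp).support := by
    rw [SimpleGraph.Walk.mem_support_rotate_iff]
    exact (hsupp y).2 hxy.snd_mem
  have hperm : (p.rotate x hxp).darts.Perm p.darts := (p.rotate_darts x hxp).perm
  have hsplit : ((p.rotate x hxp).takeUntil y hyp).darts ++
      ((p.rotate x hxp).dropUntil y hyp).darts = (p.rotate x hxp).darts := by
    rw [← SimpleGraph.Walk.darts_append, SimpleGraph.Walk.take_spec]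
  have hnd : (p.rotate x hxp).darts.Nodup := by
    rw [hperm.nodup_iff]
    exact List.Nodup.of_map _ hc.isCircuit.isTrail.edges_nodup
  rw [← hsplit, List.nodup_append] at hnd
  have hT₁ : ∀ d ∈ ((p.rotate x hxp).takeUntil y hyp).darts, d ∈ p.darts := fun d hd =>
    hperm.mem_iff.1 (hsplit ▸ List.mem_append_left _ hd)
  have hT₂ : ∀ d ∈ ((p.rotate x hxp).dropUntil y hyp).darts, d ∈ p.darts := fun d hd =>
    hperm.mem_iff.1 (hsplit ▸ List.mem_append_right _ hd)
  -- The points `x` and `y` cut the cycle into two arcs. The only dart of the tree entering `K` is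
  -- traversed once, so one of the arcs never enters `K`; as its end is over `K`, it stays there.
  by_cases h1 : ∀ d ∈ ((p.rotate x hxp).takeUntil y hyp).darts, d.snd.1 ∈ K → d.fst.1 ∈ K
  · exact (same_side_of_walk hKM hσ _ (fun d hd => hT d (hT₁ d hd)) h1 hyK).2
  by_cases h2 : ∀ d ∈ ((p.rotate x hxp).dropUntil y hyp).darts, d.snd.1 ∈ K → d.fst.1 ∈ K
  · exact (same_side_of_walk hKM hσ _ (fun d hd => hT d (hT₂ d hd)) h2 hxK).2.symm
  push Not at h1 h2
  obtain ⟨d, hd, hd1, hd2⟩ := h1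
  obtain ⟨d', hd', hd1', hd2'⟩ := h2
  obtain ⟨e1, e2⟩ := hentry (hT d (hT₁ d hd)) hd2 hd1 (hT d' (hT₂ d' hd')) hd2' hd1'
  have := (huniq _ _ (hT d (hT₁ d hd))).unique ⟨hT₁ d hd, rfl, rfl⟩ ⟨hT₂ d' hd', e1.symm, e2.symm⟩
  exact (hnd.2.2 d hd d' hd' this).elim

end CycleCuts

/-! ### From the new graph back to `G` -/

section Transfer

variable {V : Type*} {G : SimpleGraph V} {Q R : Set V} {S : Set (Comp G R)}

lemma newNode_ext {x y : NewNode S} (hx : x.1 ∉ replacedNodes S) (h : x.1 = y.1) : x = y := by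
  obtain ⟨v, i⟩ := x
  obtain ⟨w, j⟩ := y
  obtain rfl : v = w := h
  have h1 : numCopies S v = 1 := if_neg hx
  have : Subsingleton (Fin (numCopies S v)) := by
    rw [h1]
    infer_instance
  rw [Subsingleton.elim i j]

lemma exists_newNode [Finite V] {a b : V} (h : G.Adj a b) : ∃ x : NewNode S, x.1 = a := by
  have hpos : 0 < numCopies S a := by
    unfold numCopies
    split_ifs
    · exact (Set.ncard_pos (Set.toFinite _)).2 ⟨b, h⟩
    · exact one_pos
  exact ⟨⟨a, ⟨0, hpos⟩⟩, rfl⟩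

lemma notMem_replacedNodes_or_rComponent_adj {a b : V} (h : G.Adj a b) :
    (a ∉ replacedNodes S ∧ b ∉ replacedNodes S) ∨ ∃ C ∈ S, (rComponent C).Adj a b := by
  by_cases ha : a ∈ replacedNodes S
  · obtain ⟨C, hC, haC⟩ := Set.mem_iUnion₂.1 ha
    exact .inr ⟨C, hC, h, .inl haC⟩
  by_cases hb : b ∈ replacedNodes S
  · obtain ⟨C, hC, hbC⟩ := Set.mem_iUnion₂.1 hb
    exact .inr ⟨C, hC, h, .inr hbC⟩
  exact .inl ⟨ha, hb⟩

/-- If the two terminals `u, v` are connected in a subgraph `H` of `G` that avoids `M`, and no edge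
of the new graph that corresponds to `H` crosses `σ`, then `u` and `v` are on the same side. -/
lemma same_side_of_reachable [Finite V]
    (hac : ∀ C : Comp G R, (rComponent C).spanningCoe.IsAcyclic)
    {D : Comp G R → SimpleGraph (NewNode S)}
    (hD : ∀ C ∈ S, IsDFSCycle S (rComponent C) (D C)) {σ : NewNode S → Prop}
    {H : SimpleGraph V} {M : Set V} (hH : ∀ a b, H.Adj a b → G.Adj a b ∧ a ∉ M ∧ b ∉ M)
    (hM : ∀ C ∈ S, ∀ m m', m ∈ M → m' ∈ M → m ∈ (rComponent C).verts →
      m' ∈ (rComponent C).verts →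
      ∃ p : (rComponent C).spanningCoe.Walk m m', ∀ w ∈ p.support, w ∈ M)
    (hkept : ∀ x y : NewNode S, H.Adj x.1 y.1 → (keptGraph S).Adj x y → (σ x ↔ σ y))
    (hcyc : ∀ C ∈ S, ∀ x y, (D C).Adj x y → x.1 ∉ M → y.1 ∉ M → (σ x ↔ σ y))
    {u v : NewNode S} (hu : u.1 ∈ R) (huv : H.Reachable u.1 v.1) : σ u ↔ σ v := by
  by_contra hcon
  obtain ⟨p⟩ := huv
  obtain ⟨d, -, h1, h2⟩ := p.exists_boundary_dart {w | ∀ y : NewNode S, y.1 = w → (σ u ↔ σ y)}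
    (fun y hy => by rw [newNode_ext (notMem_replacedNodes hu) hy.symm])
    (fun h => hcon (h v rfl))
  obtain ⟨hG, hM1, hM2⟩ := hH _ _ d.adj
  -- The condition on all copies of `d.fst` is void unless a copy exists; a node with an incident
  -- edge has one.
  obtain ⟨x, hx⟩ := exists_newNode (S := S) hG
  refine h2 fun y hy => (h1 x hx).trans ?_
  have hd := d.adj
  rw [← hx, ← hy] at hG hd
  rw [← hx] at hM1
  rw [← hy] at hM2
  rcases notMem_replacedNodes_or_rComponent_adj (S := S) hG with ⟨h3, h4⟩ | ⟨C, hC, hadj⟩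
  · exact hkept x y hd ⟨hG, h3, h4⟩
  · exact (hD C hC).same_side (hac C) (hM C hC) (hcyc C hC) hadj hM1 hM2

/-- In the tree of an `R`-component there is a path from a given node to a given non-terminal with
all nodes, except possibly for the first one, being non-terminals. -/
lemma exists_path_rComponent {C : Comp G R} {q b : V} (hq : q ∈ (rComponent C).verts)
    (hb : b ∈ C.nodes) : ∃ p : (rComponent C).spanningCoe.Walk q b, p.IsPath ∧
      ∀ k, 0 < k → k ≤ p.length → p.getVert k ∈ C.nodes := by
  have key : ∀ {a}, a ∈ C.nodes → ∃ p : (rComponent C).spanningCoe.Walk a b, p.IsPath ∧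
      ∀ w ∈ p.support, w ∈ C.nodes := by
    intro a ha
    obtain ⟨p, hp, hpC⟩ := Comp.exists_isPath ha hb
    have he : ∀ e ∈ p.edges, e ∈ (rComponent C).spanningCoe.edgeSet := by
      intro e he
      induction e with
      | _ x y => exact rComponent_adj (hpC x (p.fst_mem_support_of_mem_edges he))
                  (p.adj_of_mem_edges he)
    exact ⟨p.transfer _ he, hp.transfer _, by simpa using hpC⟩
  by_cases hqC : q ∈ C.nodes
  · obtain ⟨p, hp, hpC⟩ := key hqC
    exact ⟨p, hp, fun k _ _ => hpC _ (p.getVert_mem_support k)⟩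
  · obtain ⟨-, c, hc, hcq⟩ := hq.resolve_left hqC
    obtain ⟨p, hp, hpC⟩ := key hc
    have hadj : (rComponent C).spanningCoe.Adj q c := (rComponent_adj hc hcq).symm
    refine ⟨.cons hadj p, hp.cons (fun h => hqC (hpC q h)), ?_⟩
    intro k hk _
    obtain ⟨k, rfl⟩ := Nat.exists_eq_succ_of_ne_zero hk.ne'
    exact hpC _ (p.getVert_mem_support k)

lemma mem_pathNodes_getVert {H : SimpleGraph V} {a b : V} (p : H.Walk a b) {w : V} :
    w ∈ pathNodes p.getVert p.length ↔ w ∈ p.support := by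
  rw [SimpleGraph.Walk.mem_support_iff_exists_getVert]
  constructor
  · rintro ⟨m, hm, rfl⟩
    exact ⟨m, rfl, hm⟩
  · rintro ⟨m, rfl, hm⟩
    exact ⟨m, hm, rfl⟩

/-- If all edges of the new graph between copies of nodes off the path `p` of the tree of `C` do
not cross `σ`, then a 2-connected pair of terminals off `p` is on the same side. -/
lemma same_side_off_path [Finite V] (hE : ∀ x y, G.Adj x y → EdgeNeeded G R Q x y)
    (hQ : ∀ w, w ∉ R → w ∈ Q) {D : Comp G R → SimpleGraph (NewNode S)}
    (hD : ∀ C ∈ S, IsDFSCycle S (rComponent C) (D C)) {σ : NewNode S → Prop} {C : Comp G R}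
    {q b : V} (p : (rComponent C).spanningCoe.Walk q b) (hp : p.IsPath)
    (hpC : ∀ k, 0 < k → k ≤ p.length → p.getVert k ∈ C.nodes) (hqQ : q ∈ Q)
    (hσ : ∀ x y, (replacedGraph S D).Adj x y → x.1 ∉ p.support → y.1 ∉ p.support →
      (σ x ↔ σ y))
    {u v : NewNode S} (hu : u.1 ∈ R) (huv : TwoConn G Q u.1 v.1) (hup : u.1 ∉ p.support)
    (hvp : v.1 ∉ p.support) : σ u ↔ σ v := by
  classical
  have hsuppC : ∀ w ∈ p.support, w = q ∨ w ∈ C.nodes := by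
    intro w hw
    obtain ⟨k, rfl, hk⟩ := SimpleGraph.Walk.mem_support_iff_exists_getVert.1 hw
    rcases Nat.eq_zero_or_pos k with rfl | h
    · exact .inl p.getVert_zero
    · exact .inr (hpC k h hk)
  have hreach := huv.reachable_off_path hE hQ (z := p.getVert) (n := p.length)
    (fun k hk => (rComponent C).spanningCoe_le (p.adj_getVert_succ hk))
    (fun k l hkl hl h => hkl.ne (hp.getVert_injOn (by simp; omega) (by simpa using hl) h))
    (fun k h1 h2 => Comp.notMem_of_mem_nodes (hpC k h1 h2)) (by simpa using hqQ)
    (by rwa [mem_pathNodes_getVert]) (by rwa [mem_pathNodes_getVert])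
  refine same_side_of_reachable (M := {w | w ∈ p.support}) (rComponent_isAcyclic hE hQ) hD
    ?_ ?_ ?_ ?_ hu hreach
  · intro a b hab
    obtain ⟨h1, h2⟩ := SimpleGraph.deleteEdges_adj.1 hab
    refine ⟨h1, fun h => h2 ⟨a, ?_, by simp⟩, fun h => h2 ⟨b, ?_, by simp⟩⟩ <;>
    rwa [mem_pathNodes_getVert]
  -- In its own tree the path is connected. Another tree can share with it only the node `q`, since
  -- the other nodes of the path are non-terminals of `C`.
  · intro C' hC' m m' hm hm' hmv hmv'
    by_cases hCC' : C' = C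
    · subst hCC'
      refine ⟨(p.takeUntil m hm).reverse.append (p.takeUntil m' hm'), ?_⟩
      intro w hw
      rw [SimpleGraph.Walk.mem_support_append_iff, SimpleGraph.Walk.support_reverse,
        List.mem_reverse] at hw
      rcases hw with hw | hw
      · exact p.support_takeUntil_subset_support hm hw
      · exact p.support_takeUntil_subset_support hm' hw
    · have hq : ∀ m, m ∈ p.support → m ∈ (rComponent C').verts → m = q := by
        intro m hm hmv
        refine (hsuppC m hm).resolve_right fun h => ?_
        rcases mem_nodes_or_mem_of_mem_verts hmv with h1 | h1
        · exact hCC' (Comp.eq_of_mem_nodes h1 h)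
        · exact Comp.notMem_of_mem_nodes h h1
      obtain rfl := hq m hm hmv
      obtain rfl := hq m' hm' hmv'
      exact ⟨.nil, by simp⟩
  · intro x y hxy hk
    obtain ⟨h1, h2⟩ := SimpleGraph.deleteEdges_adj.1 hxy
    refine hσ x y (.inl hk) (fun h => h2 ⟨x.1, ?_, by simp⟩) (fun h => h2 ⟨y.1, ?_, by simp⟩) <;>
    rwa [mem_pathNodes_getVert]
  · intro C hC x y hxy
    refine hσ x y (.inr ?_)
    simp only [SimpleGraph.iSup_adj]
    exact ⟨C, hC, hxy⟩

end Transfer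

/-! ### Capacities of the cuts of the new graph -/

section Capacity

variable {V : Type*} {G : SimpleGraph V} {Q R : Set V} {S : Set (Comp G R)}
  {D : Comp G R → SimpleGraph (NewNode S)} {X : Biset (NewNode S)}
  {N : Finset (Sym2 (NewNode S))}

lemma Biset.covers_mk {U : Type*} {X : Biset U} {x y : U} :
    X.Covers s(x, y) ↔ (x ∈ X.inner ∧ y ∉ X.outer) ∨ (y ∈ X.inner ∧ x ∉ X.outer) := by
  constructor
  · rintro ⟨a, b, h, ha, hb⟩
    rcases Sym2.eq_iff.1 h with ⟨rfl, rfl⟩ | ⟨rfl, rfl⟩ <;> tauto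
  · rintro (⟨h1, h2⟩ | ⟨h1, h2⟩)
    · exact ⟨x, y, rfl, h1, h2⟩
    · exact ⟨y, x, Sym2.eq_swap, h1, h2⟩

lemma Biset.covers_iff_crosses {U : Type*} {X : Biset U} {x y : U} (hx : x ∉ X.boundary)
    (hy : y ∉ X.boundary) : X.Covers s(x, y) ↔ Crosses (· ∈ X.inner) s(x, y) := by
  rw [Biset.covers_mk, crosses_mk]
  have h1 : x ∈ X.outer ↔ x ∈ X.inner :=
    ⟨fun h => by_contra fun h' => hx ⟨h, h'⟩, fun h => X.inner_subset h⟩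
  have h2 : y ∈ X.outer ↔ y ∈ X.inner :=
    ⟨fun h => by_contra fun h' => hy ⟨h, h'⟩, fun h => X.inner_subset h⟩
  rw [h1, h2]
  tauto

lemma Biset.mem_inner_iff_of_not_covers {U : Type*} {X : Biset U} {x y : U}
    (hx : x ∉ X.boundary) (hy : y ∉ X.boundary) (h : ¬ X.Covers s(x, y)) :
    x ∈ X.inner ↔ y ∈ X.inner := by
  rw [Biset.covers_iff_crosses hx hy, crosses_mk, not_not] at h
  exact h

lemma mem_edgeSet_replacedGraph {e : Sym2 (NewNode S)} :
    e ∈ (replacedGraph S D).edgeSet ↔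
      e ∈ (keptGraph S).edgeSet ∨ ∃ C ∈ S, e ∈ (D C).edgeSet := by
  induction e with
  | _ x y => simp [replacedGraph]

lemma replacedGraph_adj_of_mem {C : Comp G R} (hC : C ∈ S) {x y : NewNode S}
    (h : (D C).Adj x y) : (replacedGraph S D).Adj x y :=
  mem_edgeSet_replacedGraph.2 (.inr ⟨C, hC, (D C).mem_edgeSet.2 h⟩)

lemma half_le_replacedCapacity (e : Sym2 (NewNode S)) : 1 / 2 ≤ replacedCapacity S e := by
  unfold replacedCapacity
  split_ifs <;> norm_num

lemma replacedCapacity_le_one (e : Sym2 (NewNode S)) : replacedCapacity S e ≤ 1 := by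
  unfold replacedCapacity
  split_ifs <;> norm_num

lemma replacedCapacity_of_mem {e : Sym2 (NewNode S)} (he : e ∈ (keptGraph S).edgeSet) :
    replacedCapacity S e = 1 := if_pos he

lemma sum_replacedCapacity_le {A : Finset (Sym2 (NewNode S))} (hA : A ⊆ N) :
    ∑ e ∈ A, replacedCapacity S e ≤ ∑ e ∈ N, replacedCapacity S e :=
  Finset.sum_le_sum_of_subset_of_nonneg hA fun e _ _ =>
    le_trans (by norm_num) (half_le_replacedCapacity e)

lemma card_div_two_le_sum {A : Finset (Sym2 (NewNode S))} (hA : A ⊆ N) :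
    (A.card : ℝ) / 2 ≤ ∑ e ∈ N, replacedCapacity S e := by
  refine le_trans ?_ (sum_replacedCapacity_le hA)
  have := Finset.card_nsmul_le_sum A (replacedCapacity S) (1 / 2)
    fun e _ => half_le_replacedCapacity e
  rw [nsmul_eq_mul] at this
  linarith

lemma one_add_card_div_two_le_sum {A : Finset (Sym2 (NewNode S))} (hA : A ⊆ N)
    {e : Sym2 (NewNode S)} (he : e ∈ N) (hk : e ∈ (keptGraph S).edgeSet) (heA : e ∉ A) :
    1 + (A.card : ℝ) / 2 ≤ ∑ e ∈ N, replacedCapacity S e := by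
  classical
  refine le_trans ?_ (sum_replacedCapacity_le (Finset.insert_subset he hA))
  rw [Finset.sum_insert heA, replacedCapacity_of_mem hk]
  exact add_le_add_right (card_div_two_le_sum (N := A) subset_rfl) 1

variable (hD : ∀ C ∈ S, IsDFSCycle S (rComponent C) (D C))
include hD

lemma exists_mem_nodes_of_mem_edgeSet {C : Comp G R} (hC : C ∈ S) {e : Sym2 (NewNode S)}
    (he : e ∈ (D C).edgeSet) : ∃ x ∈ e, x.1 ∈ C.nodes := by
  induction e with
  | _ x y =>
    rcases ((hD C hC).adj he).2 with h | h
    · exact ⟨x, by simp, h⟩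
    · exact ⟨y, by simp, h⟩

lemma notMem_keptGraph_edgeSet {C : Comp G R} (hC : C ∈ S) {e : Sym2 (NewNode S)}
    (he : e ∈ (D C).edgeSet) : e ∉ (keptGraph S).edgeSet := by
  obtain ⟨x, hx, hxC⟩ := exists_mem_nodes_of_mem_edgeSet hD hC he
  induction e with
  | _ a b =>
    intro h
    have h' : (keptGraph S).Adj a b := h
    rcases Sym2.mem_iff.1 hx with rfl | rfl
    · exact h'.2.1 (mem_replacedNodes hC hxC)
    · exact h'.2.2 (mem_replacedNodes hC hxC)

lemma comp_eq_of_mem_edgeSet {C C' : Comp G R} (hC : C ∈ S) (hC' : C' ∈ S)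
    {e : Sym2 (NewNode S)} (he : e ∈ (D C).edgeSet) (he' : e ∈ (D C').edgeSet) : C = C' := by
  obtain ⟨x, hx, hxC⟩ := exists_mem_nodes_of_mem_edgeSet hD hC he
  have hv : x.1 ∈ (rComponent C').verts := by
    induction e with
    | _ a b =>
      have h := (hD C' hC').adj he'
      rcases Sym2.mem_iff.1 hx with rfl | rfl
      · exact h.fst_mem
      · exact h.snd_mem
  rcases mem_nodes_or_mem_of_mem_verts hv with h | h
  · exact Comp.eq_of_mem_nodes hxC h
  · exact (Comp.notMem_of_mem_nodes hxC h).elim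

-- Where no boundary node lies over the tree, covering the biset means crossing its inner part, and
-- a cycle does this an even number of times.
open Classical in
lemma even_card_filter (hN : ∀ e, e ∈ N ↔ e ∈ (replacedGraph S D).edgeSet ∧ X.Covers e)
    {C : Comp G R} (hC : C ∈ S)
    (hX : ∀ y : NewNode S, y.1 ∈ (rComponent C).verts → y ∉ X.boundary) :
    Even (N.filter (· ∈ (D C).edgeSet)).card := by
  refine (hD C hC).even_card (· ∈ X.inner) _ fun e => ?_
  rw [Finset.mem_filter, hN]
  have hsub : e ∈ (D C).edgeSet → e ∈ (replacedGraph S D).edgeSet := fun h =>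
    mem_edgeSet_replacedGraph.2 (.inr ⟨C, hC, h⟩)
  have hiff : e ∈ (D C).edgeSet → (X.Covers e ↔ Crosses (· ∈ X.inner) e) := by
    intro he
    induction e with
    | _ x y =>
      have h := (hD C hC).adj he
      exact Biset.covers_iff_crosses (hX x h.fst_mem) (hX y h.snd_mem)
  tauto

open Classical in
lemma two_le_card_filter (hN : ∀ e, e ∈ N ↔ e ∈ (replacedGraph S D).edgeSet ∧ X.Covers e)
    {C : Comp G R} (hC : C ∈ S)
    (hX : ∀ y : NewNode S, y.1 ∈ (rComponent C).verts → y ∉ X.boundary)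
    {e : Sym2 (NewNode S)} (he : e ∈ N) (heC : e ∈ (D C).edgeSet) :
    2 ≤ (N.filter (· ∈ (D C).edgeSet)).card := by
  obtain ⟨k, hk⟩ := even_card_filter hD hN hC hX
  have : 0 < (N.filter (· ∈ (D C).edgeSet)).card :=
    Finset.card_pos.2 ⟨e, Finset.mem_filter.2 ⟨he, heC⟩⟩
  omega

/-- Some edge covers the biset. If it is kept it has capacity 1, and otherwise parity provides a
second edge of its cycle. -/
lemma one_le_capacity [Finite V] (hE : ∀ x y, G.Adj x y → EdgeNeeded G R Q x y)
    (hQ : ∀ w, w ∉ R → w ∈ Q)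
    (hN : ∀ e, e ∈ N ↔ e ∈ (replacedGraph S D).edgeSet ∧ X.Covers e) (hX : X.boundary = ∅)
    {u v : NewNode S} (hu : u.1 ∈ R) (huX : u ∈ X.inner) (hvX : v ∉ X.outer)
    (huv : G.Reachable u.1 v.1) : 1 ≤ ∑ e ∈ N, replacedCapacity S e := by
  classical
  have hX' : ∀ y, y ∉ X.boundary := by simp [hX]
  obtain ⟨e, he⟩ : N.Nonempty := by
    by_contra hne
    rw [Finset.not_nonempty_iff_eq_empty] at hne
    have hcov : ∀ x y, (replacedGraph S D).Adj x y → (x ∈ X.inner ↔ y ∈ X.inner) := by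
      intro x y hxy
      refine Biset.mem_inner_iff_of_not_covers (hX' x) (hX' y) fun h => ?_
      have := (hN s(x, y)).2 ⟨hxy, h⟩
      simp [hne] at this
    refine hvX (X.inner_subset ((same_side_of_reachable (M := ∅) (H := G)
      (rComponent_isAcyclic hE hQ) hD (fun a b h => ⟨h, by simp, by simp⟩) (by simp)
      (fun x y _ hk => hcov x y (.inl hk)) (fun C hC x y hxy _ _ => hcov x y ?_) hu huv).1 huX))
    exact replacedGraph_adj_of_mem hC hxy
  rcases mem_edgeSet_replacedGraph.1 ((hN e).1 he).1 with hk | ⟨C, hC, heC⟩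
  · simpa using one_add_card_div_two_le_sum (Finset.empty_subset N) he hk (by simp)
  · have h1 := two_le_card_filter hD hN hC (fun y _ => hX' y) he heC
    have h2 := card_div_two_le_sum (N := N) (Finset.filter_subset (· ∈ (D C).edgeSet) N)
    have h3 : (2 : ℝ) ≤ ((N.filter (· ∈ (D C).edgeSet)).card : ℝ) := by exact_mod_cast h1
    linarith

/-- A second covering edge adds capacity 1, by itself if it is kept and by parity otherwise. If
there is none, the edge of `G` under `e₀` would separate a 2-connected pair. -/
lemma two_le_capacity_of_kept [Finite V] (hE : ∀ x y, G.Adj x y → EdgeNeeded G R Q x y)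
    (hQ : ∀ w, w ∉ R → w ∈ Q)
    (hN : ∀ e, e ∈ N ↔ e ∈ (replacedGraph S D).edgeSet ∧ X.Covers e) (hX : X.boundary = ∅)
    {u v : NewNode S} (hu : u.1 ∈ R) (huX : u ∈ X.inner) (hvX : v ∉ X.outer)
    (huv : TwoConn G Q u.1 v.1) {e₀ : Sym2 (NewNode S)} (he₀ : e₀ ∈ N)
    (hk₀ : e₀ ∈ (keptGraph S).edgeSet) : 2 ≤ ∑ e ∈ N, replacedCapacity S e := by
  classical
  have hX' : ∀ y, y ∉ X.boundary := by simp [hX]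
  by_cases hne : ∃ e ∈ N, e ≠ e₀
  · obtain ⟨e, he, hne⟩ := hne
    rcases mem_edgeSet_replacedGraph.1 ((hN e).1 he).1 with hk | ⟨C, hC, heC⟩
    · have h1 := sum_replacedCapacity_le (A := {e, e₀}) (N := N) (by
        intro x hx
        rcases Finset.mem_insert.1 hx with rfl | hx
        · exact he
        · exact Finset.mem_singleton.1 hx ▸ he₀)
      rw [Finset.sum_pair hne, replacedCapacity_of_mem hk, replacedCapacity_of_mem hk₀] at h1
      linarith
    · have h1 := two_le_card_filter hD hN hC (fun y _ => hX' y) he heC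
      have h2 := one_add_card_div_two_le_sum
        (Finset.filter_subset (· ∈ (D C).edgeSet) N) he₀ hk₀
        (fun h => notMem_keptGraph_edgeSet hD hC (Finset.mem_filter.1 h).2 hk₀)
      have h3 : (2 : ℝ) ≤ ((N.filter (· ∈ (D C).edgeSet)).card : ℝ) := by exact_mod_cast h1
      linarith
  · exfalso
    push Not at hne
    have hcov : ∀ x y, (replacedGraph S D).Adj x y → s(x, y) ≠ e₀ →
        (x ∈ X.inner ↔ y ∈ X.inner) := by
      intro x y hxy hxye
      exact Biset.mem_inner_iff_of_not_covers (hX' x) (hX' y) fun h =>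
        hxye (hne _ ((hN _).2 ⟨hxy, h⟩))
    refine hvX (X.inner_subset ((same_side_of_reachable (M := ∅)
      (rComponent_isAcyclic hE hQ) hD (fun a b h => ⟨(SimpleGraph.deleteEdges_adj.1 h).1, by simp,
        by simp⟩) (by simp) (fun x y hxy hk => hcov x y (.inl hk) ?_)
      (fun C hC x y hxy _ _ => hcov x y ?_ ?_) hu
      (huv {e₀.map Sigma.fst} (.inl ⟨_, rfl⟩))).1 huX))
    · rintro rfl
      exact (SimpleGraph.deleteEdges_adj.1 hxy).2 (by simp)
    · exact replacedGraph_adj_of_mem hC hxy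
    · rintro rfl
      exact notMem_keptGraph_edgeSet hD hC hxy hk₀

/-- Without kept edges, capacity below 2 means fewer than four covering edges, and parity leaves
exactly two, both on one cycle. The path in the tree between non-terminal ends of these edges meets
both and contains no terminal. Off this path no edge covers the biset, while the pair stays
connected. -/
lemma two_le_capacity [Finite V] (hE : ∀ x y, G.Adj x y → EdgeNeeded G R Q x y)
    (hQ : ∀ w, w ∉ R → w ∈ Q)
    (hN : ∀ e, e ∈ N ↔ e ∈ (replacedGraph S D).edgeSet ∧ X.Covers e) (hX : X.boundary = ∅)
    {u v : NewNode S} (hu : u.1 ∈ R) (hv : v.1 ∈ R) (huX : u ∈ X.inner) (hvX : v ∉ X.outer)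
    (huv : TwoConn G Q u.1 v.1) : 2 ≤ ∑ e ∈ N, replacedCapacity S e := by
  classical
  have hX' : ∀ y, y ∉ X.boundary := by simp [hX]
  by_cases hkept : ∃ e ∈ N, e ∈ (keptGraph S).edgeSet
  · obtain ⟨e, he, hk⟩ := hkept
    exact two_le_capacity_of_kept hD hE hQ hN hX hu huX hvX huv he hk
  push Not at hkept
  by_contra hlt
  push Not at hlt
  have hcard : N.card < 4 := by
    by_contra h
    have h1 := card_div_two_le_sum (N := N) subset_rfl
    have h2 : (4 : ℝ) ≤ N.card := by exact_mod_cast not_lt.1 h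
    linarith
  have hone := one_le_capacity hD hE hQ hN hX hu huX hvX ((huv {s(u.1, u.1)} (.inl ⟨_, rfl⟩)).mono
    (SimpleGraph.deleteEdges_le _))
  obtain ⟨e, he⟩ : N.Nonempty := by
    by_contra hne
    rw [Finset.not_nonempty_iff_eq_empty] at hne
    simp only [hne, Finset.sum_empty] at hone
    linarith
  obtain ⟨C, hC, heC⟩ := (mem_edgeSet_replacedGraph.1 ((hN e).1 he).1).resolve_left (hkept e he)
  have hall : ∀ e' ∈ N, e' ∈ (D C).edgeSet := by
    intro e' he'
    obtain ⟨C', hC', heC'⟩ :=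
      (mem_edgeSet_replacedGraph.1 ((hN e').1 he').1).resolve_left (hkept e' he')
    by_cases hCC : C' = C
    · exact hCC ▸ heC'
    · exfalso
      have h1 := two_le_card_filter hD hN hC (fun y _ => hX' y) he heC
      have h2 := two_le_card_filter hD hN hC' (fun y _ => hX' y) he' heC'
      have hdisj : Disjoint (N.filter (· ∈ (D C).edgeSet)) (N.filter (· ∈ (D C').edgeSet)) := by
        rw [Finset.disjoint_left]
        intro f hf hf'
        exact hCC (comp_eq_of_mem_edgeSet hD hC' hC (Finset.mem_filter.1 hf').2
          (Finset.mem_filter.1 hf).2)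
      have h3 := Finset.card_le_card (Finset.union_subset
        (Finset.filter_subset (· ∈ (D C).edgeSet) N) (Finset.filter_subset (· ∈ (D C').edgeSet) N))
      rw [Finset.card_union_of_disjoint hdisj] at h3
      omega
  have htwo : N.card = 2 := by
    have h1 := two_le_card_filter hD hN hC (fun y _ => hX' y) he heC
    obtain ⟨k, hk⟩ := even_card_filter hD hN hC (fun y _ => hX' y)
    rw [Finset.filter_true_of_mem hall] at h1 hk
    omega
  obtain ⟨e₁, e₂, -, hN2⟩ := Finset.card_eq_two.1 htwo
  obtain ⟨x₁, hx₁, hxC₁⟩ := exists_mem_nodes_of_mem_edgeSet hD hC (hall e₁ (by simp [hN2]))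
  obtain ⟨x₂, hx₂, hxC₂⟩ := exists_mem_nodes_of_mem_edgeSet hD hC (hall e₂ (by simp [hN2]))
  obtain ⟨p, hp, hpC⟩ := exists_path_rComponent (C := C) (.inl hxC₁) hxC₂
  have hpR : ∀ w ∈ p.support, w ∉ R := by
    intro w hw
    obtain ⟨k, rfl, hk⟩ := SimpleGraph.Walk.mem_support_iff_exists_getVert.1 hw
    rcases Nat.eq_zero_or_pos k with rfl | h
    · rw [p.getVert_zero]
      exact Comp.notMem_of_mem_nodes hxC₁
    · exact Comp.notMem_of_mem_nodes (hpC k h hk)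
  refine hvX (X.inner_subset ((same_side_off_path hE hQ hD p hp hpC
    (hQ _ (Comp.notMem_of_mem_nodes hxC₁)) (fun x y hxy hxp hyp => ?_) hu huv
    (fun h => hpR _ h hu) (fun h => hpR _ h hv)).1 huX))
  refine Biset.mem_inner_iff_of_not_covers (hX' x) (hX' y) fun h => ?_
  have hmem := (hN s(x, y)).2 ⟨hxy, h⟩
  rw [hN2, Finset.mem_insert, Finset.mem_singleton] at hmem
  have key : ∀ z : NewNode S, z.1 ∈ p.support → z ∉ s(x, y) := by
    rintro z hz hzm
    rcases Sym2.mem_iff.1 hzm with rfl | rfl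
    · exact hxp hz
    · exact hyp hz
  rcases hmem with rfl | rfl
  · exact key x₁ p.start_mem_support hx₁
  · exact key x₂ p.end_mem_support hx₂

/-- Capacity below 1 leaves at most one covering edge, lying on a cycle. Without any, deleting the
node under `q` would separate the pair. With one, the tree path from that node to a non-terminal end
of the edge is deleted. All copies of the node under `q` are discarded in this way, although only
one of them is in the boundary. -/
lemma one_le_capacity_of_boundary [Finite V] (hE : ∀ x y, G.Adj x y → EdgeNeeded G R Q x y)
    (hQ : ∀ w, w ∉ R → w ∈ Q)
    (hN : ∀ e, e ∈ N ↔ e ∈ (replacedGraph S D).edgeSet ∧ X.Covers e) {q : NewNode S}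
    (hX : X.boundary = {q}) (hq : q.1 ∈ Q) {u v : NewNode S} (hu : u.1 ∈ R) (hv : v.1 ∈ R)
    (huX : u ∈ X.inner) (hvX : v ∉ X.outer) (huv : TwoConn G Q u.1 v.1) :
    1 ≤ ∑ e ∈ N, replacedCapacity S e := by
  classical
  have hqB : q ∈ X.boundary := by simp [hX]
  have hqu : q.1 ≠ u.1 := fun h =>
    hqB.2 ((newNode_ext (notMem_replacedNodes hu) h.symm) ▸ huX)
  have hqv : q.1 ≠ v.1 := fun h =>
    hvX ((newNode_ext (notMem_replacedNodes hv) h.symm) ▸ hqB.1)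
  have hX' : ∀ y : NewNode S, y.1 ≠ q.1 → y ∉ X.boundary := by
    rintro y hy hyB
    rw [hX, Set.mem_singleton_iff] at hyB
    exact hy (by rw [hyB])
  by_contra hlt
  push Not at hlt
  have hkept : ∀ e ∈ N, e ∉ (keptGraph S).edgeSet := by
    intro e he hk
    have := one_add_card_div_two_le_sum (Finset.empty_subset N) he hk (by simp)
    simp only [Finset.card_empty, Nat.cast_zero, zero_div, add_zero] at this
    linarith
  have hcard : N.card < 2 := by
    by_contra h
    have h1 := card_div_two_le_sum (N := N) subset_rfl
    have h2 : (2 : ℝ) ≤ N.card := by exact_mod_cast not_lt.1 h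
    linarith
  rcases N.eq_empty_or_nonempty with hne | ⟨e, he⟩
  · have hcov : ∀ x y, (replacedGraph S D).Adj x y → x.1 ≠ q.1 → y.1 ≠ q.1 →
        (x ∈ X.inner ↔ y ∈ X.inner) := by
      intro x y hxy hx hy
      refine Biset.mem_inner_iff_of_not_covers (hX' x hx) (hX' y hy) fun h => ?_
      have := (hN s(x, y)).2 ⟨hxy, h⟩
      simp [hne] at this
    have hadj : ∀ a b, (G.deleteEdges {e | q.1 ∈ e}).Adj a b →
        G.Adj a b ∧ a ∉ ({q.1} : Set V) ∧ b ∉ ({q.1} : Set V) := by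
      intro a b h
      obtain ⟨h1, h2⟩ := SimpleGraph.deleteEdges_adj.1 h
      refine ⟨h1, ?_, ?_⟩ <;>
      · rintro rfl
        simp at h2
    refine hvX (X.inner_subset ((same_side_of_reachable (M := {q.1})
      (rComponent_isAcyclic hE hQ) hD hadj ?_
      (fun x y hxy hk => hcov x y (.inl hk) (hadj _ _ hxy).2.1 (hadj _ _ hxy).2.2)
      (fun C hC x y hxy => hcov x y (replacedGraph_adj_of_mem hC hxy)) hu
      (huv _ (.inr ⟨q.1, hq, hqu, hqv, rfl⟩))).1 huX))
    rintro C - m m' rfl rfl - -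
    exact ⟨.nil, by simp⟩
  · obtain ⟨C, hC, heC⟩ := (mem_edgeSet_replacedGraph.1 ((hN e).1 he).1).resolve_left (hkept e he)
    have huniq : ∀ f ∈ N, f = e := fun f hf =>
      Finset.card_le_one.1 (by omega) f hf e he
    -- If `q` were not over the tree, parity would give a second covering edge.
    have hqT : q.1 ∈ (rComponent C).verts := by
      by_contra hqT
      have h1 := two_le_card_filter hD hN hC (fun y hy => hX' y fun h => hqT (h ▸ hy)) he heC
      have h2 := Finset.card_le_card (Finset.filter_subset (· ∈ (D C).edgeSet) N)
      omega
    obtain ⟨x₁, hx₁, hxC₁⟩ := exists_mem_nodes_of_mem_edgeSet hD hC heC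
    obtain ⟨p, hp, hpC⟩ := exists_path_rComponent hqT hxC₁
    have hpR : ∀ w ∈ p.support, w ∈ R → w = q.1 := by
      intro w hw hwR
      obtain ⟨k, rfl, hk⟩ := SimpleGraph.Walk.mem_support_iff_exists_getVert.1 hw
      rcases Nat.eq_zero_or_pos k with rfl | h
      · exact p.getVert_zero
      · exact (Comp.notMem_of_mem_nodes (hpC k h hk) hwR).elim
    have hqp : ∀ y : NewNode S, y.1 ∉ p.support → y ∉ X.boundary := fun y hy =>
      hX' y fun h => hy (by rw [h]; exact p.start_mem_support)
    refine hvX (X.inner_subset ((same_side_off_path hE hQ hD p hp hpC hq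
      (fun x y hxy hxp hyp => ?_) hu huv (fun h => hqu (hpR _ h hu).symm)
      (fun h => hqv (hpR _ h hv).symm)).1 huX))
    refine Biset.mem_inner_iff_of_not_covers (hqp x hxp) (hqp y hyp) fun h => ?_
    have hmem := huniq _ ((hN s(x, y)).2 ⟨hxy, h⟩)
    rw [← hmem] at hx₁
    rcases Sym2.mem_iff.1 hx₁ with rfl | rfl
    · exact hxp p.end_mem_support
    · exact hyp p.end_mem_support

end Capacity

theorem isFractionallyRQConnected_replacedGraph {V : Type*} [Fintype V] {G : SimpleGraph V}
    {R Q : Set V} {r : Sym2 V → ℕ} (hQ : ∀ w, w ∉ R → w ∈ Q)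
    (hr : ∀ u ∈ R, ∀ v ∈ R, u ≠ v → r s(u, v) ∈ ({0, 1, 2} : Set ℕ))
    (hG : IsRQConnected G R r Q) (hE : ∀ x y, G.Adj x y → EdgeNeeded G R Q x y)
    {S : Set (Comp G R)} {D : Comp G R → SimpleGraph (NewNode S)}
    (hD : ∀ C ∈ S, IsDFSCycle S (rComponent C) (D C)) :
    IsFractionallyRQConnected (replacedGraph S D) (replacedCapacity S) (copiesOf S R)
      (liftRequirement S r) (copiesOf S Q) := by
  classical
  refine ⟨fun e _ => ⟨le_trans (by norm_num) (half_le_replacedCapacity e),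
    replacedCapacity_le_one e⟩, fun X => ?_⟩
  set N := Finset.univ.filter (fun e => e ∈ (replacedGraph S D).edgeSet ∧ X.Covers e) with hNdef
  have hN : ∀ e, e ∈ N ↔ e ∈ (replacedGraph S D).edgeSet ∧ X.Covers e := by
    simp [hNdef]
  have hnonneg : 0 ≤ ∑ e ∈ N, replacedCapacity S e :=
    Finset.sum_nonneg fun e _ => le_trans (by norm_num) (half_le_replacedCapacity e)
  unfold bisetRequirement
  split_ifs with hB
  swap
  · exact hnonneg
  set A := Finset.univ.filter
    (fun e => e ∈ demandEdges (copiesOf S R) (liftRequirement S r) ∧ X.Covers e) with hA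
  rcases Nat.le_total (A.sup (liftRequirement S r)) X.boundary.ncard with hle | hle
  · have : ((A.sup (liftRequirement S r) : ℕ) : ℝ) ≤ (X.boundary.ncard : ℝ) := by
      exact_mod_cast hle
    linarith
  rcases hle.eq_or_lt with heq | hlt
  · rw [heq]
    simpa using hnonneg
  have hAne : A.Nonempty := by
    by_contra h
    rw [Finset.not_nonempty_iff_eq_empty] at h
    rw [h] at hlt
    simp at hlt
  obtain ⟨e, heA, hsup⟩ := Finset.exists_mem_eq_sup A hAne (liftRequirement S r)
  rw [hsup] at hlt ⊢
  obtain ⟨hdem, u, v, rfl, huX, hvX⟩ := (Finset.mem_filter.1 heA).2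
  have hu : u.1 ∈ R := hdem.2.1 u (by simp)
  have hv : v.1 ∈ R := hdem.2.1 v (by simp)
  have huv : u.1 ≠ v.1 := by
    intro h
    have := newNode_ext (notMem_replacedNodes hu) h
    exact hdem.1 (by simpa using this)
  have hpos : 0 < r s(u.1, v.1) := hdem.2.2
  have hdem' : s(u.1, v.1) ∈ demandEdges R r := by
    refine ⟨by simpa using huv, ?_, hpos⟩
    intro w hw
    rcases Sym2.mem_iff.1 hw with rfl | rfl
    · exact hu
    · exact hv
  have hlift : liftRequirement S r s(u, v) = r s(u.1, v.1) := rfl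
  rw [hlift] at hlt ⊢
  -- The requirement exceeds the size of the boundary, so it is 1 with empty boundary, or 2 with at
  -- most one boundary node.
  rcases hr _ hu _ hv huv with h0 | h1 | h2
  · omega
  · rw [h1] at hlt ⊢
    have hb : X.boundary.ncard = 0 := by omega
    have hX : X.boundary = ∅ := (Set.ncard_eq_zero (Set.toFinite _)).1 hb
    rw [hb]
    simpa using one_le_capacity hD hE hQ hN hX hu huX hvX (hG.reachable hdem')
  · rw [Set.mem_singleton_iff] at h2
    rw [h2] at hlt ⊢
    have htwo := hG.twoConn hdem' h2
    rcases Nat.lt_or_ge 0 X.boundary.ncard with hb | hb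
    · have hb1 : X.boundary.ncard = 1 := by omega
      obtain ⟨q, hq⟩ := Set.ncard_eq_one.1 hb1
      have hqQ : q.1 ∈ Q := hB (by simp [hq])
      have := one_le_capacity_of_boundary hD hE hQ hN hq hqQ hu hv huX hvX htwo
      rw [hb1]
      push_cast
      linarith
    · have hb0 : X.boundary.ncard = 0 := by omega
      have hX : X.boundary = ∅ := (Set.ncard_eq_zero (Set.toFinite _)).1 hb0
      rw [hb0]
      simpa using two_le_capacity hD hE hQ hN hX hu hv huX hvX htwo

end SurvivableNetwork

theorem theorem5 {V : Type*} [Fintype V] (G : SimpleGraph V) (R Q : Set V) (r : Sym2 V → ℕ)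
    (hQR : Q ∪ R = Set.univ)
    (hr : ∀ u ∈ R, ∀ v ∈ R, u ≠ v → r s(u, v) ∈ ({0, 1, 2} : Set ℕ))
    (hG : SurvivableNetwork.IsMinimallyRQConnected G R r Q) :
    (∀ C : SurvivableNetwork.Comp G R, (SurvivableNetwork.rComponent C).coe.IsTree) ∧
    ∀ S : Set (SurvivableNetwork.Comp G R),
      (∀ C ∈ S, ∃ D : SimpleGraph (SurvivableNetwork.NewNode S),
        SurvivableNetwork.IsDFSCycle S (SurvivableNetwork.rComponent C) D) ∧
      ∀ D : SurvivableNetwork.Comp G R → SimpleGraph (SurvivableNetwork.NewNode S),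
        (∀ C ∈ S, SurvivableNetwork.IsDFSCycle S (SurvivableNetwork.rComponent C) (D C)) →
        SurvivableNetwork.IsFractionallyRQConnected
          (SurvivableNetwork.replacedGraph S D)
          (SurvivableNetwork.replacedCapacity S)
          (SurvivableNetwork.copiesOf S R)
          (SurvivableNetwork.liftRequirement S r)
          (SurvivableNetwork.copiesOf S Q) := by
  have hQ : ∀ w, w ∉ R → w ∈ Q := fun w hw =>
    ((Set.ext_iff.1 hQR w).2 trivial).resolve_right hw
  have hE : ∀ x y, G.Adj x y → SurvivableNetwork.EdgeNeeded G R Q x y :=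
    fun x y h => hG.edgeNeeded hr h
  exact ⟨fun C => SurvivableNetwork.rComponent_isTree hE hQ C, fun S =>
    ⟨fun C hC => SurvivableNetwork.exists_isDFSCycle hE hQ
      (fun c hc => SurvivableNetwork.exists_two_neighbors hG hE hc) hC,
    fun D hD => SurvivableNetwork.isFractionallyRQConnected_replacedGraph hQ hr hG.1 hE hD⟩⟩
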